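/- Let $C = F_2/\gamma_4(F_2)$ be the Cartan group, that is, the free nilpotent group of step $3$ on two generators $x,y$ (here $\gamma_1(F_2)=F_2$ and $\gamma_{k+1}(F_2)=[\gamma_k(F_2),F_2]$). Let $S=\{x^{\pm1},y^{\pm1}\}$, let $\|g\|_S$ be the word length, let $d_S(g,h)=\|g^{-1}h\|_S$, and let $g\mapsto\hat g\in\mathbb Z^2$ be the homomorphism with $\hat x=(1,0)$, $\hat y=(0,1)$. Horofunctions. The horofunction boundary $\partial(C,d_S)$ consists of the pointwise limits of functions $h\mapsto d_S(g,h)-d_S(g,e)$, $g\in C$, that are not themselves of this form. The group $C$ acts on it by $(g\cdot\varphi)(h)=\varphi(g^{-1}h)-\varphi(g^{-1})$. The reduced boundary $\partial^r(C,d_S)$ is the quotient of $\partial(C,d_S)$ by the relation that $\varphi-\psi$ is bounded, with the induced action of $C$; $[\varphi]$ is the class of $\varphi$. An infinite geodesic $\gamma=(\gamma_n)_{n\ge0}$ defines the Busemann point $b_\gamma(h)=\lim_{n\to\infty}\big(d_S(\gamma_n,h)-d_S(\gamma_n,e)\big)$ of $\partial(C,d_S)$. Staircases. For $u=(u_1,u_2)\in\mathbb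 S^1$ with $u_1,u_2\ge 0$, let $\hat\gamma_u=(\hat\gamma_{u,n})_{n\ge0}$ be the lattice path in $\mathbb Z^2$ from $(0,0)$ with steps $(1,0)$ and $(0,1)$ that separates the unit squares of the first quadrant whose centre is above the ray $\mathbb R^+u$ from those whose centre is below it: from $(a,b)$ it makes the step $(1,0)$ if $(a+\frac12,b+\frac12)$ lies above the ray and the step $(0,1)$ if it lies below the ray. The squares whose centre is on the ray (there are some exactly when $u$ has the direction of $(a,b)$ with $a,b$ odd integers) are passed alternately below and above, starting with either of the two. For $u$ in another quadrant, $\hat\gamma_u$ is the mirror image, under the reflections in the coordinate axes, of the staircase of $(|u_1|,|u_2|)$. Let $\gamma_u$ be the lift of $\hat\gamma_u$ to $C$ with $\gamma_{u,0}=e$, obtained by replacing each step $(\pm1,0)$ by right multiplication by $x^{\pm1}$ and each step $(0,\pm1)$ by right multiplication by $y^{\pm1}$. It is an infinite geodesic of $(C,d_S)$. Theorem. For every choice, for each direction $u$, of how the alternation starts: 1. The points $[b_{\gamma_u}]\in\partial^r(C,d_S)$, $u\in\mathbb S^1$, are pairwise distinct. In particular, the set of classes in $\partial^r(C,d_S)$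 of Busemann points is uncountable. 2. For every $u\in\mathbb S^1$, $$\mathrm{Stab}_C([b_{\gamma_u}])\subseteq\{g\in C:\hat g\in\mathbb Ru\},$$ and if $u$ is irrational, i.e. is not a positive multiple of a nonzero integer vector, then $\{g\in C:\hat g\in\mathbb Ru\}=[C,C]$. -/

import Mathlib

open Filter Topology

noncomputable section

/-! ## Word metrics, horofunctions and Busemann points -/

section Horofunctions

variable {G : Type*} [Group G]

/-- `S` is a symmetric set that generates the group `G`: `S = S⁻¹`, and every element of `G` is a
product of elements of `S`. -/
structure IsSymmGenerating (S : Set G) : Prop where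
  inv_mem : ∀ s ∈ S, s⁻¹ ∈ S
  closure_eq : Submonoid.closure S = ⊤

/-- The word length `‖g‖_S`: the least length of a word in `S` that represents `g`. -/
def wordLength (S : Set G) (g : G) : ℕ :=
  sInf {n : ℕ | ∃ l : List G, (∀ s ∈ l, s ∈ S) ∧ l.prod = g ∧ l.length = n}

/-- The word metric `d_S(g, h) = ‖g⁻¹ h‖_S`. -/
def wordDist (S : Set G) (g h : G) : ℕ := wordLength S (g⁻¹ * h)

/-- The image of the point `x` in the space of functions on `G` that vanish at `1`:
`h ↦ d(x, h) - d(x, 1)`. -/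
def horoEmbed (S : Set G) (x : G) : G → ℝ :=
  fun h => (wordDist S x h : ℝ) - (wordDist S x 1 : ℝ)

/-- The horofunctions of `(G, d_S)`: limits, for pointwise convergence, of the functions
`horoEmbed S x`, that are not themselves of this form. -/
def horofunctions (S : Set G) : Set (G → ℝ) :=
  closure (Set.range (horoEmbed S)) \ Set.range (horoEmbed S)

/-- The horofunction boundary `∂(G, d_S)`. -/
def HoroBoundary (S : Set G) : Type _ := {φ : G → ℝ // φ ∈ horofunctions S}

/-- The action of `G` on functions that vanish at `1`:
`(g • φ)(h) = φ(g⁻¹ h) - φ(g⁻¹)`. -/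
def horoTranslate (g : G) (φ : G → ℝ) : G → ℝ := fun h => φ (g⁻¹ * h) - φ g⁻¹

theorem horoTranslate_mul (g₁ g₂ : G) (φ : G → ℝ) :
    horoTranslate (g₁ * g₂) φ = horoTranslate g₁ (horoTranslate g₂ φ) := by
  funext h
  simp [horoTranslate, mul_assoc]

theorem horoTranslate_one {φ : G → ℝ} (hφ : φ 1 = 0) : horoTranslate 1 φ = φ := by
  funext h
  simp [horoTranslate, hφ]

theorem horoTranslate_horoEmbed (S : Set G) (g x : G) :
    horoTranslate g (horoEmbed S x) = horoEmbed S (g * x) := by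
  funext h
  simp [horoTranslate, horoEmbed, wordDist, mul_assoc]

theorem horoTranslate_continuous (g : G) : Continuous (horoTranslate g) := by
  unfold horoTranslate
  fun_prop

theorem horofunctions_one {S : Set G} {φ : G → ℝ} (hφ : φ ∈ horofunctions S) : φ 1 = 0 := by
  have hc : IsClosed {ψ : G → ℝ | ψ 1 = 0} := isClosed_eq (continuous_apply 1) continuous_const
  refine closure_minimal ?_ hc hφ.1
  rintro _ ⟨x, rfl⟩
  simp [horoEmbed]

theorem horoTranslate_mem {S : Set G} (g : G) {φ : G → ℝ} (hφ : φ ∈ horofunctions S) :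
    horoTranslate g φ ∈ horofunctions S := by
  refine ⟨?_, ?_⟩
  · have hmaps : Set.MapsTo (horoTranslate g) (Set.range (horoEmbed S))
        (Set.range (horoEmbed S)) := by
      rintro _ ⟨x, rfl⟩
      exact ⟨g * x, (horoTranslate_horoEmbed S g x).symm⟩
    exact hmaps.closure (horoTranslate_continuous g) hφ.1
  · rintro ⟨x, hx⟩
    refine hφ.2 ⟨g⁻¹ * x, ?_⟩
    rw [← horoTranslate_horoEmbed, hx, ← horoTranslate_mul, inv_mul_cancel,
      horoTranslate_one (horofunctions_one hφ)]

instance HoroBoundary.instMulAction (S : Set G) : MulAction G (HoroBoundary S) where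
  smul g φ := ⟨horoTranslate g φ.1, horoTranslate_mem g φ.2⟩
  one_smul φ := Subtype.ext (horoTranslate_one (horofunctions_one φ.2))
  mul_smul g₁ g₂ φ := Subtype.ext (horoTranslate_mul g₁ g₂ φ.1)

/-- Two horofunctions are equivalent if their difference is a bounded function. -/
def HoroBoundary.boundedSetoid (S : Set G) : Setoid (HoroBoundary S) where
  r φ ψ := ∃ K : ℝ, ∀ h : G, |φ.1 h - ψ.1 h| ≤ K
  iseqv :=
    { refl := fun φ => ⟨0, fun h => by simp⟩
      symm := fun ⟨K, hK⟩ => ⟨K, fun h => by rw [abs_sub_comm]; exact hK h⟩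
      trans := fun ⟨K, hK⟩ ⟨L, hL⟩ =>
        ⟨K + L, fun h => (abs_sub_le _ _ _).trans (add_le_add (hK h) (hL h))⟩ }

/-- The reduced horofunction boundary `∂ʳ(G, d_S)`: horofunctions modulo bounded functions. -/
def ReducedHoroBoundary (S : Set G) : Type _ := Quotient (HoroBoundary.boundedSetoid S)

/-- The class `[φ]` of a horofunction in the reduced boundary. -/
def HoroBoundary.toReduced {S : Set G} (φ : HoroBoundary S) : ReducedHoroBoundary S :=
  Quotient.mk (HoroBoundary.boundedSetoid S) φ

/-- The action of `G` on the reduced boundary, `g • [φ] = [g • φ]`. -/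
instance ReducedHoroBoundary.instMulAction (S : Set G) : MulAction G (ReducedHoroBoundary S) where
  smul g := Quotient.map (sa := HoroBoundary.boundedSetoid S)
    (sb := HoroBoundary.boundedSetoid S) (fun φ => g • φ) (by
      rintro φ ψ ⟨K, hK⟩
      refine ⟨K + K, fun h => ?_⟩
      change |(φ.1 (g⁻¹ * h) - φ.1 g⁻¹) - (ψ.1 (g⁻¹ * h) - ψ.1 g⁻¹)| ≤ K + K
      have h1 := abs_le.1 (hK (g⁻¹ * h))
      have h2 := abs_le.1 (hK g⁻¹)
      exact abs_le.2 ⟨by linarith, by linarith⟩)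
  one_smul := by
    rintro ⟨φ⟩
    exact congrArg HoroBoundary.toReduced (one_smul G φ)
  mul_smul g₁ g₂ := by
    rintro ⟨φ⟩
    exact congrArg HoroBoundary.toReduced (mul_smul g₁ g₂ φ)

/-- An infinite geodesic of `(G, d_S)`, parametrized by `ℕ`. -/
def IsGeodesicRay (S : Set G) (γ : ℕ → G) : Prop :=
  ∀ m k : ℕ, wordDist S (γ m) (γ (m + k)) = k

/-- The Busemann function `b_γ(h) = lim_n (d(γ_n, h) - d(γ_n, 1))`. -/
def busemann (S : Set G) (γ : ℕ → G) : G → ℝ :=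
  fun h => limUnder atTop (fun n => horoEmbed S (γ n) h)

theorem wordLength_set_nonempty {S : Set G} (hS : IsSymmGenerating S) (g : G) :
    {n : ℕ | ∃ l : List G, (∀ s ∈ l, s ∈ S) ∧ l.prod = g ∧ l.length = n}.Nonempty := by
  have hg : g ∈ Submonoid.closure S := by rw [hS.closure_eq]; trivial
  obtain ⟨l, hl, hp⟩ := Submonoid.exists_list_of_mem_closure hg
  exact ⟨l.length, l, hl, hp, rfl⟩

theorem exists_word {S : Set G} (hS : IsSymmGenerating S) (g : G) :
    ∃ l : List G, (∀ s ∈ l, s ∈ S) ∧ l.prod = g ∧ l.length = wordLength S g :=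
  Nat.sInf_mem (wordLength_set_nonempty hS g)

theorem wordLength_le {S : Set G} (l : List G) (hl : ∀ s ∈ l, s ∈ S) :
    wordLength S l.prod ≤ l.length :=
  Nat.sInf_le ⟨l, hl, rfl, rfl⟩

theorem wordLength_mul_le {S : Set G} (hS : IsSymmGenerating S) (g h : G) :
    wordLength S (g * h) ≤ wordLength S g + wordLength S h := by
  obtain ⟨l, hl, rfl, e⟩ := exists_word hS g
  obtain ⟨l', hl', rfl, e'⟩ := exists_word hS h
  rw [← e, ← e', ← List.prod_append, ← List.length_append]
  refine wordLength_le _ fun s hs => ?_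
  rcases List.mem_append.1 hs with hs | hs
  · exact hl s hs
  · exact hl' s hs

theorem wordLength_inv_le {S : Set G} (hS : IsSymmGenerating S) (g : G) :
    wordLength S g⁻¹ ≤ wordLength S g := by
  obtain ⟨l, hl, rfl, e⟩ := exists_word hS g
  rw [← e, List.prod_inv_reverse]
  refine (wordLength_le _ ?_).trans (by simp)
  intro s hs
  rw [List.mem_reverse, List.mem_map] at hs
  obtain ⟨t, ht, rfl⟩ := hs
  exact hS.inv_mem t (hl t ht)

theorem wordDist_comm {S : Set G} (hS : IsSymmGenerating S) (g h : G) :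
    wordDist S g h = wordDist S h g := by
  unfold wordDist
  refine le_antisymm ?_ ?_
  · simpa using wordLength_inv_le hS (h⁻¹ * g)
  · simpa using wordLength_inv_le hS (g⁻¹ * h)

theorem wordDist_triangle {S : Set G} (hS : IsSymmGenerating S) (x y z : G) :
    wordDist S x z ≤ wordDist S x y + wordDist S y z := by
  have := wordLength_mul_le hS (x⁻¹ * y) (y⁻¹ * z)
  simpa [wordDist, mul_assoc] using this

theorem busemann_tendsto {S : Set G} (hS : IsSymmGenerating S) {γ : ℕ → G}
    (hγ : IsGeodesicRay S γ) :
    Tendsto (fun n => horoEmbed S (γ n)) atTop (𝓝 (busemann S γ)) := by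
  -- along the ray, `d(γ_n, h) - n` is nonincreasing and bounded below
  have key : ∀ h : G, ∃ a : ℝ, Tendsto (fun n : ℕ => (wordDist S (γ n) h : ℝ) - n) atTop (𝓝 a) := by
    intro h
    refine ⟨_, tendsto_atTop_ciInf ?_ ⟨-(wordDist S (γ 0) h : ℝ), ?_⟩⟩
    · refine antitone_nat_of_succ_le fun n => ?_
      have h1 := wordDist_triangle hS (γ (n + 1)) (γ n) h
      rw [wordDist_comm hS (γ (n + 1)) (γ n), hγ n 1] at h1
      have h2 : (wordDist S (γ (n + 1)) h : ℝ) ≤ 1 + wordDist S (γ n) h := by exact_mod_cast h1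
      push_cast
      linarith
    · rintro _ ⟨n, rfl⟩
      have h1 := wordDist_triangle hS (γ 0) h (γ n)
      have h3 := hγ 0 n
      rw [zero_add] at h3
      rw [h3, wordDist_comm hS h] at h1
      have h2 : (n : ℝ) ≤ wordDist S (γ 0) h + wordDist S (γ n) h := by exact_mod_cast h1
      simp only
      linarith
  rw [tendsto_pi_nhds]
  intro h
  obtain ⟨a, ha⟩ := key h
  obtain ⟨c, hc⟩ := key 1
  have hlim : Tendsto (fun n => horoEmbed S (γ n) h) atTop (𝓝 (a - c)) := by
    refine (ha.sub hc).congr fun n => ?_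
    simp [horoEmbed]
  exact tendsto_nhds_limUnder ⟨_, hlim⟩

theorem busemann_mem {S : Set G} (hS : IsSymmGenerating S) {γ : ℕ → G}
    (hγ : IsGeodesicRay S γ) : busemann S γ ∈ horofunctions S := by
  have ht := busemann_tendsto hS hγ
  refine ⟨mem_closure_of_tendsto ht (Eventually.of_forall fun n => ⟨γ n, rfl⟩), ?_⟩
  rintro ⟨x, hx⟩
  -- `b_γ(γ_m) = b_γ(γ_0) - m` is unbounded below
  have hval : ∀ m : ℕ, busemann S γ (γ m) = busemann S γ (γ 0) - m := by
    intro m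
    have h1 := (tendsto_pi_nhds.1 ht) (γ m)
    have h2 := ((tendsto_pi_nhds.1 ht) (γ 0)).sub_const (m : ℝ)
    refine tendsto_nhds_unique (h1.congr' ?_) h2
    filter_upwards [eventually_ge_atTop m] with n hn
    obtain ⟨k, rfl⟩ := Nat.exists_eq_add_of_le hn
    have e1 : wordDist S (γ (m + k)) (γ m) = k := by rw [wordDist_comm hS, hγ m k]
    have e2 : wordDist S (γ (m + k)) (γ 0) = m + k := by
      rw [wordDist_comm hS]
      simpa using hγ 0 (m + k)
    simp only [horoEmbed, e1, e2]
    push_cast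
    ring
  have hbd : ∀ h : G, -(wordDist S x 1 : ℝ) ≤ busemann S γ h := by
    intro h
    rw [← hx]
    simp [horoEmbed]
  obtain ⟨m, hm⟩ := exists_nat_gt (busemann S γ (γ 0) + wordDist S x 1)
  have := hbd (γ m)
  rw [hval m] at this
  linarith

/-- The Busemann point of `∂(G, d_S)` defined by an infinite geodesic `γ`. -/
def busemannPoint {S : Set G} (hS : IsSymmGenerating S) (γ : ℕ → G) (hγ : IsGeodesicRay S γ) :
    HoroBoundary S :=
  ⟨busemann S γ, busemann_mem hS hγ⟩

/-- The set of all Busemann points in the reduced boundary. -/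
def reducedBusemannPoints {S : Set G} (hS : IsSymmGenerating S) : Set (ReducedHoroBoundary S) :=
  {ξ | ∃ (γ : ℕ → G) (hγ : IsGeodesicRay S γ), ξ = (busemannPoint hS γ hγ).toReduced}

end Horofunctions

/-! ## The Cartan group -/

/-- The Cartan group: the free nilpotent group of step 3 on two generators, that is, the free group
on two generators modulo the fourth term of its lower central series (Mathlib numbers the terms of
the series from `0`). -/
abbrev CartanGroup : Type :=
  FreeGroup (Fin 2) ⧸ (⊤ : Subgroup (FreeGroup (Fin 2))).lowerCentralSeries 3

namespace CartanGroup

/-- The first standard generator. -/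
def x : CartanGroup := QuotientGroup.mk (FreeGroup.of 0)

/-- The second standard generator. -/
def y : CartanGroup := QuotientGroup.mk (FreeGroup.of 1)

/-- The standard generating set `S = {x, x⁻¹, y, y⁻¹}`. -/
def gens : Set CartanGroup := {x, x⁻¹, y, y⁻¹}

/-- The projection `g ↦ ĝ` to the abelianization `ℤ²`, with `x ↦ (1, 0)` and `y ↦ (0, 1)`. -/
def hatHom : CartanGroup →* Multiplicative (ℤ × ℤ) :=
  QuotientGroup.lift _
    (FreeGroup.lift ![Multiplicative.ofAdd ((1 : ℤ), (0 : ℤ)),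
      Multiplicative.ofAdd ((0 : ℤ), (1 : ℤ))])
    (((Subgroup.lowerCentralSeries_antitone (S := (⊤ : Subgroup (FreeGroup (Fin 2))))
      (by norm_num : 1 ≤ 3)).trans (Subgroup.top_lowerCentralSeries_one).le).trans
      (Abelianization.commutator_subset_ker _))

/-- The projection `ĝ ∈ ℤ²` of `g`. -/
def hat (g : CartanGroup) : ℤ × ℤ := Multiplicative.toAdd (hatHom g)

/-- The projection `ĝ`, as a vector of the Euclidean plane. -/
def hatVec (g : CartanGroup) : EuclideanSpace ℝ (Fin 2) := !₂[((hat g).1 : ℝ), ((hat g).2 : ℝ)]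

theorem hat_mul (g h : CartanGroup) : hat (g * h) = hat g + hat h := by simp [hat]

theorem hat_one : hat 1 = 0 := by simp [hat]

theorem hat_inv (g : CartanGroup) : hat g⁻¹ = -hat g := by simp [hat]

theorem hat_zpow (g : CartanGroup) (n : ℤ) : hat (g ^ n) = n • hat g := by simp [hat]

theorem hat_x : hat x = (1, 0) := by
  have h : hatHom x = FreeGroup.lift ![Multiplicative.ofAdd ((1 : ℤ), (0 : ℤ)),
      Multiplicative.ofAdd ((0 : ℤ), (1 : ℤ))] (FreeGroup.of 0) := rfl
  rw [hat, h, FreeGroup.lift_apply_of]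
  rfl

theorem hat_y : hat y = (0, 1) := by
  have h : hatHom y = FreeGroup.lift ![Multiplicative.ofAdd ((1 : ℤ), (0 : ℤ)),
      Multiplicative.ofAdd ((0 : ℤ), (1 : ℤ))] (FreeGroup.of 1) := rfl
  rw [hat, h, FreeGroup.lift_apply_of]
  rfl

theorem isSymmGenerating_gens : IsSymmGenerating gens where
  inv_mem := by
    rintro s (rfl | rfl | rfl | rfl) <;> simp [gens]
  closure_eq := by
    rw [eq_top_iff]
    rintro ⟨w⟩ -
    induction w using FreeGroup.induction_on with
    | C1 => exact one_mem _
    | of i =>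
      refine Submonoid.subset_closure ?_
      fin_cases i
      · exact Or.inl rfl
      · exact Or.inr (Or.inr (Or.inl rfl))
    | inv_of i _ =>
      refine Submonoid.subset_closure ?_
      fin_cases i
      · exact Or.inr (Or.inl rfl)
      · exact Or.inr (Or.inr (Or.inr rfl))
    | mul a b ha hb => exact mul_mem ha hb

theorem hat_prod_le (l : List CartanGroup) (hl : ∀ s ∈ l, s ∈ gens) :
    |(hat l.prod).1| + |(hat l.prod).2| ≤ l.length := by
  induction l with
  | nil => simp [hat_one]
  | cons s t ih =>
    have h1 := ih fun r hr => hl r (List.mem_cons_of_mem _ hr)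
    have h2 : |(hat s).1| + |(hat s).2| = 1 := by
      rcases hl s List.mem_cons_self with rfl | rfl | rfl | rfl <;>
        simp [hat_inv, hat_x, hat_y]
    rw [List.prod_cons, hat_mul, List.length_cons, Prod.fst_add, Prod.snd_add]
    have h3 := abs_add_le (hat s).1 (hat t.prod).1
    have h4 := abs_add_le (hat s).2 (hat t.prod).2
    push_cast
    linarith

theorem hat_le_wordLength (g : CartanGroup) :
    |(hat g).1| + |(hat g).2| ≤ wordLength gens g := by
  obtain ⟨l, hl, rfl, e⟩ := exists_word isSymmGenerating_gens g
  rw [← e]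
  exact hat_prod_le l hl

end CartanGroup

/-! ## The staircase in direction `u` -/

/-- The circle of directions `S¹` in the plane. -/
abbrev Direction : Type := Metric.sphere (0 : EuclideanSpace ℝ (Fin 2)) 1

/-- A direction is rational if it is the direction of a nonzero integer vector. -/
def Direction.IsRational (u : Direction) : Prop :=
  ∃ a b : ℤ, (a, b) ≠ (0, 0) ∧
    ∃ t : ℝ, 0 < t ∧ (u : EuclideanSpace ℝ (Fin 2)) = t • !₂[(a : ℝ), (b : ℝ)]

namespace Staircase

/-- The staircase is drawn first in the closed first quadrant, for the ray spanned by `(p, q)` with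
`p, q ≥ 0`. The state is the current lattice point `(a, b)` together with the side on which the
next square centred on the ray is passed. The next unit square has centre `(a + 1/2, b + 1/2)`.
If this centre is above the ray, the staircase has to pass below the square, so it makes the
step `(1, 0)`; if it is below the ray, it makes the step `(0, 1)`. If the centre is on the ray,
the staircase passes below the square if the flag is `true` and above it otherwise. -/
def StepsRight (p q : ℝ) (s : (ℕ × ℕ) × Bool) : Prop :=
  (s.1.1 + 1 / 2 : ℝ) * q < (s.1.2 + 1 / 2 : ℝ) * p ∨
    ((s.1.1 + 1 / 2 : ℝ) * q = (s.1.2 + 1 / 2 : ℝ) * p ∧ s.2 = true)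

open Classical in
/-- One step of the staircase. The flag is switched when a square centred on the ray has been
passed, so that these squares are passed alternately above and below. -/
def next (p q : ℝ) (s : (ℕ × ℕ) × Bool) : (ℕ × ℕ) × Bool :=
  (if StepsRight p q s then (s.1.1 + 1, s.1.2) else (s.1.1, s.1.2 + 1),
    if (s.1.1 + 1 / 2 : ℝ) * q = (s.1.2 + 1 / 2 : ℝ) * p then !s.2 else s.2)

/-- The states of the staircase for the ray spanned by `(p, q)`, starting at the origin with
flag `ε`. -/
def state (p q : ℝ) (ε : Bool) : ℕ → (ℕ × ℕ) × Bool
  | 0 => ((0, 0), ε)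
  | n + 1 => next p q (state p q ε n)

/-- The staircase `γ̂_u` in `ℤ²`: the staircase for the direction `(|u₁|, |u₂|)` of the first
quadrant, reflected in the coordinate axes into the quadrant of `u`. -/
def latticePath (u : Direction) (ε : Bool) (n : ℕ) : ℤ × ℤ :=
  ((SignType.sign (u.1 0) : ℤ) * ((state |u.1 0| |u.1 1| ε n).1.1 : ℤ),
    (SignType.sign (u.1 1) : ℤ) * ((state |u.1 0| |u.1 1| ε n).1.2 : ℤ))

/-- The lift `γ_u` of the staircase to the Cartan group, starting at the identity: a step `(±1, 0)`
is lifted to right multiplication by `x^{±1}`, and a step `(0, ±1)` to that by `y^{±1}`. -/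
def path (u : Direction) (ε : Bool) : ℕ → CartanGroup
  | 0 => 1
  | n + 1 => path u ε n *
      (CartanGroup.x ^ ((latticePath u ε (n + 1)).1 - (latticePath u ε n).1) *
        CartanGroup.y ^ ((latticePath u ε (n + 1)).2 - (latticePath u ε n).2))

theorem hat_path (u : Direction) (ε : Bool) (n : ℕ) :
    CartanGroup.hat (path u ε n) = latticePath u ε n := by
  induction n with
  | zero => rw [path, CartanGroup.hat_one]; simp [latticePath, state]; rfl
  | succ n ih =>
    rw [path, CartanGroup.hat_mul, CartanGroup.hat_mul, CartanGroup.hat_zpow,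
      CartanGroup.hat_zpow, ih, CartanGroup.hat_x, CartanGroup.hat_y]
    ext <;> simp

theorem coord_ne_zero (u : Direction) : ¬ (u.1 0 = 0 ∧ u.1 1 = 0) := by
  rintro ⟨h0, h1⟩
  have h : ‖u.1‖ = 1 := by simp
  have : u.1 = 0 := by
    ext i
    fin_cases i
    · exact h0
    · exact h1
  rw [this, norm_zero] at h
  exact zero_ne_one h

theorem latticePath_step (u : Direction) (ε : Bool) (n : ℕ) :
    (∃ s : ℤ, (s = 1 ∨ s = -1) ∧ s = SignType.sign (u.1 0) ∧
      state |u.1 0| |u.1 1| ε (n + 1) =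
        (((state |u.1 0| |u.1 1| ε n).1.1 + 1, (state |u.1 0| |u.1 1| ε n).1.2),
          (state |u.1 0| |u.1 1| ε (n + 1)).2)) ∨
    (∃ s : ℤ, (s = 1 ∨ s = -1) ∧ s = SignType.sign (u.1 1) ∧
      state |u.1 0| |u.1 1| ε (n + 1) =
        (((state |u.1 0| |u.1 1| ε n).1.1, (state |u.1 0| |u.1 1| ε n).1.2 + 1),
          (state |u.1 0| |u.1 1| ε (n + 1)).2)) := by
  have hsign : ∀ r : ℝ, r ≠ 0 →
      ((SignType.sign r : ℤ) = 1 ∨ (SignType.sign r : ℤ) = -1) := by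
    intro r hr
    rcases lt_or_gt_of_ne hr with h | h <;> simp [h]
  set σ := state |u.1 0| |u.1 1| ε n with hσ
  have ha : (0 : ℝ) < (σ.1.1 : ℝ) + 1 / 2 := by positivity
  have hb : (0 : ℝ) < (σ.1.2 : ℝ) + 1 / 2 := by positivity
  by_cases hr : StepsRight |u.1 0| |u.1 1| σ
  · left
    refine ⟨_, hsign (u.1 0) ?_, rfl, ?_⟩
    · intro h0
      rcases hr with hr | ⟨hr, -⟩
      · rw [h0, abs_zero, mul_zero] at hr
        exact absurd hr (not_lt.2 (by positivity))
      · rw [h0, abs_zero, mul_zero] at hr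
        refine coord_ne_zero u ⟨h0, ?_⟩
        rcases mul_eq_zero.1 hr with h | h
        · exact absurd h ha.ne'
        · exact abs_eq_zero.1 h
    · refine Prod.ext ?_ rfl
      simp only [state, next, ← hσ, if_pos hr]
  · right
    refine ⟨_, hsign (u.1 1) ?_, rfl, ?_⟩
    · intro h1
      refine hr (Or.inl ?_)
      rw [h1, abs_zero, mul_zero]
      exact mul_pos hb (abs_pos.2 fun h0 => coord_ne_zero u ⟨h0, h1⟩)
    · refine Prod.ext ?_ rfl
      simp only [state, next, ← hσ, if_neg hr]

theorem path_step (u : Direction) (ε : Bool) (n : ℕ) :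
    ∃ s ∈ CartanGroup.gens, path u ε (n + 1) = path u ε n * s := by
  refine ⟨_, ?_, rfl⟩
  rcases latticePath_step u ε n with ⟨s, hs, he, hst⟩ | ⟨s, hs, he, hst⟩ <;>
  · simp only [latticePath, ← he]
    rw [hst]
    rcases hs with rfl | rfl <;> simp [CartanGroup.gens]

/-- The path `γ_u` is an infinite geodesic, since its projection to `ℤ²` is geodesic. -/
theorem isGeodesicRay_path (u : Direction) (ε : Bool) :
    IsGeodesicRay CartanGroup.gens (path u ε) := by
  have hword : ∀ m k : ℕ, ∃ l : List CartanGroup, (∀ s ∈ l, s ∈ CartanGroup.gens) ∧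
      l.length = k ∧ path u ε (m + k) = path u ε m * l.prod := by
    intro m k
    induction k with
    | zero => exact ⟨[], by simp, rfl, by simp⟩
    | succ k ih =>
      obtain ⟨l, hl, hk, hp⟩ := ih
      obtain ⟨s, hs, he⟩ := path_step u ε (m + k)
      refine ⟨l ++ [s], ?_, by simp [hk], ?_⟩
      · intro r hr
        rcases List.mem_append.1 hr with hr | hr
        · exact hl r hr
        · rw [List.mem_singleton.1 hr]; exact hs
      · rw [← add_assoc, he, hp]
        simp [mul_assoc]
  have hnorm : ∀ m k : ℕ, (k : ℤ) ≤
      |(latticePath u ε (m + k)).1 - (latticePath u ε m).1| +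
        |(latticePath u ε (m + k)).2 - (latticePath u ε m).2| := by
    intro m k
    have hst : ∀ k : ℕ, ∃ a b : ℕ, a + b = k ∧
        (state |u.1 0| |u.1 1| ε (m + k)).1 =
          ((state |u.1 0| |u.1 1| ε m).1.1 + a, (state |u.1 0| |u.1 1| ε m).1.2 + b) ∧
        (a ≠ 0 → |(SignType.sign (u.1 0) : ℤ)| = 1) ∧
        (b ≠ 0 → |(SignType.sign (u.1 1) : ℤ)| = 1) := by
      intro k
      induction k with
      | zero => exact ⟨0, 0, rfl, rfl, by simp, by simp⟩
      | succ k ih =>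
        obtain ⟨a, b, hab, hs, h1, h2⟩ := ih
        rcases latticePath_step u ε (m + k) with ⟨s, hs1, he, hst⟩ | ⟨s, hs1, he, hst⟩
        · refine ⟨a + 1, b, by omega, ?_, fun _ => ?_, h2⟩
          · rw [← add_assoc, hst, hs]; rfl
          · rw [← he]; rcases hs1 with rfl | rfl <;> simp
        · refine ⟨a, b + 1, by omega, ?_, h1, fun _ => ?_⟩
          · rw [← add_assoc, hst, hs]; rfl
          · rw [← he]; rcases hs1 with rfl | rfl <;> simp
    obtain ⟨a, b, hab, hs, h1, h2⟩ := hst k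
    simp only [latticePath, hs]
    push_cast
    rw [← mul_sub, ← mul_sub, add_sub_cancel_left, add_sub_cancel_left, abs_mul, abs_mul,
      Nat.abs_cast, Nat.abs_cast]
    have e1 : |(SignType.sign (u.1 0) : ℤ)| * (a : ℤ) = a := by
      by_cases h : a = 0
      · simp [h]
      · rw [h1 h, one_mul]
    have e2 : |(SignType.sign (u.1 1) : ℤ)| * (b : ℤ) = b := by
      by_cases h : b = 0
      · simp [h]
      · rw [h2 h, one_mul]
    rw [e1, e2]
    omega
  intro m k
  refine le_antisymm ?_ ?_
  · obtain ⟨l, hl, hk, hp⟩ := hword m k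
    rw [wordDist, hp, inv_mul_cancel_left, ← hk]
    exact wordLength_le l hl
  · have h1 := CartanGroup.hat_le_wordLength ((path u ε m)⁻¹ * path u ε (m + k))
    rw [CartanGroup.hat_mul, CartanGroup.hat_inv, hat_path, hat_path, neg_add_eq_sub] at h1
    have h2 := (hnorm m k).trans h1
    exact_mod_cast h2

/-- The Busemann point `b_{γ_u}` of the boundary `∂(C, d_S)`. -/
def busemannPt (u : Direction) (ε : Bool) : HoroBoundary CartanGroup.gens :=
  busemannPoint CartanGroup.isSymmGenerating_gens (path u ε) (isGeodesicRay_path u ε)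

end Staircase

end

open Filter Topology

noncomputable section

/-! Reflections in the axes and the diagonal reduce to a ray of slope `s` with `0 ≤ s ≤ 1` in the
first quadrant. A step to the right in column `a` at height `b` is charged `columnCost s a b`, the
square of its distance from the ray at mid-column minus the least such square over all integer
heights. A step to the left is charged the opposite of this, and vertical steps are free. Two facts
make this cost useful. It depends only on the group element that a word represents
(`cost_eq_of_eval_eq`), because the expanded square involves only the moments `A` and `B`, which are
invariants of step 3. And it vanishes on the staircase, which passes every column at a nearest
height. Hence every word for an element of the ray has cost zero.

Only steps to the left can have negative cost, of order at most `M ^ 2` if the path stays within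
distance `M` of the ray. An excursion to distance `M` followed by a return costs about `M ^ 3`, up
to a similar `M ^ 2` allowance for each downward step. So a word for a point of the ray strays from
it at most linearly in its number of backward steps (`abs_height_le_of_cost_eq_zero`).

If the Busemann function at `c` is at most `R - ‖c‖`, then `c` lies on a word to some `γ_n` with
boundedly many backward steps, and the projection of `c` is at bounded distance from the point of
the ray reached at time `‖c‖` (`exists_hat_bound`). If the Busemann functions of `u` and `v` differ
by a bounded function, this applies to the points of `γ_u` and the direction `v`, which forces `u =
v`.

If `c` translates the Busemann function to one at bounded distance, then a geodesic to `c` followed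
by a long piece of the translated staircase extends to such a word. A translate at height at least 2
pays at least 2 in each column, which boundedly many backward steps cannot recover
(`abs_height_lt_two`). Applied to all powers of an element of the stabilizer, this puts its
projection on the line of `u`. -/

/-! ## A nilpotent group of moments of lattice paths -/

/-- The record of a lattice path from the origin: its end point `(a, b)`, and the sums
`z = ∑ ± j`, `A = ∑ ± j²`, `B = ∑ ± (2 i + 1) j` over its horizontal steps, where `j` is the height
of the step, `i` and `i + 1` are the abscissas of its ends, and the sign is the direction. -/
@[ext]
structure MomentGroup where
  a : ℤ
  b : ℤ
  z : ℤ
  A : ℤ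
  B : ℤ

namespace MomentGroup

/-- The product is the record of a concatenation. The second path is translated by `(g.a, g.b)`, so
its sums change by the expansions of `(j + g.b) ^ 2` and `(2 * (i + g.a) + 1) * (j + g.b)`, where `∑
± 1 = h.a` and `∑ ± (2 * i + 1) = h.a ^ 2`. -/
instance : Mul MomentGroup :=
  ⟨fun g h => ⟨g.a + h.a, g.b + h.b, g.z + g.b * h.a + h.z,
    g.A + g.b ^ 2 * h.a + 2 * g.b * h.z + h.A,
    g.B + 2 * g.a * g.b * h.a + 2 * g.a * h.z + g.b * h.a ^ 2 + h.B⟩⟩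

instance : One MomentGroup := ⟨⟨0, 0, 0, 0, 0⟩⟩

instance : Inv MomentGroup :=
  ⟨fun g => ⟨-g.a, -g.b, g.a * g.b - g.z, -g.A - g.b ^ 2 * g.a + 2 * g.b * g.z,
    -g.B - g.a ^ 2 * g.b + 2 * g.a * g.z⟩⟩

@[simp] theorem mul_a (g h : MomentGroup) : (g * h).a = g.a + h.a := rfl
@[simp] theorem mul_b (g h : MomentGroup) : (g * h).b = g.b + h.b := rfl
@[simp] theorem mul_z (g h : MomentGroup) : (g * h).z = g.z + g.b * h.a + h.z := rfl
@[simp] theorem mul_A (g h : MomentGroup) :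
    (g * h).A = g.A + g.b ^ 2 * h.a + 2 * g.b * h.z + h.A := rfl
@[simp] theorem mul_B (g h : MomentGroup) :
    (g * h).B = g.B + 2 * g.a * g.b * h.a + 2 * g.a * h.z + g.b * h.a ^ 2 + h.B := rfl
@[simp] theorem one_a : (1 : MomentGroup).a = 0 := rfl
@[simp] theorem one_b : (1 : MomentGroup).b = 0 := rfl
@[simp] theorem one_z : (1 : MomentGroup).z = 0 := rfl
@[simp] theorem one_A : (1 : MomentGroup).A = 0 := rfl
@[simp] theorem one_B : (1 : MomentGroup).B = 0 := rfl
@[simp] theorem inv_a (g : MomentGroup) : g⁻¹.a = -g.a := rfl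
@[simp] theorem inv_b (g : MomentGroup) : g⁻¹.b = -g.b := rfl
@[simp] theorem inv_z (g : MomentGroup) : g⁻¹.z = g.a * g.b - g.z := rfl
@[simp] theorem inv_A (g : MomentGroup) :
    g⁻¹.A = -g.A - g.b ^ 2 * g.a + 2 * g.b * g.z := rfl
@[simp] theorem inv_B (g : MomentGroup) :
    g⁻¹.B = -g.B - g.a ^ 2 * g.b + 2 * g.a * g.z := rfl

instance : Group MomentGroup :=
  Group.ofLeftAxioms
    (fun g h k => by ext <;> simp <;> ring)
    (fun g => by ext <;> simp)
    (fun g => by ext <;> simp <;> ring)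

/-- The record of one step to the right. -/
def X : MomentGroup := ⟨1, 0, 0, 0, 0⟩

/-- The record of one step upwards. -/
def Y : MomentGroup := ⟨0, 1, 0, 0, 0⟩

/-- The moment group is nilpotent of step 3. -/
theorem lowerCentralSeries_le_ker (f : FreeGroup (Fin 2) →* MomentGroup) :
    (⊤ : Subgroup (FreeGroup (Fin 2))).lowerCentralSeries 3 ≤ f.ker := by
  -- Each commutator with an arbitrary element kills one more layer of coordinates: first `a` and
  -- `b`, then `z`, then `A` and `B`.
  have h1 : ∀ w ∈ (⊤ : Subgroup (FreeGroup (Fin 2))).lowerCentralSeries 1,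
      (f w).a = 0 ∧ (f w).b = 0 := by
    let K : Subgroup (FreeGroup (Fin 2)) :=
      { carrier := {w | (f w).a = 0 ∧ (f w).b = 0}
        mul_mem' := by rintro g h ⟨h1, h2⟩ ⟨h3, h4⟩; simp [*]
        one_mem' := by simp
        inv_mem' := by rintro g ⟨h1, h2⟩; simp [*] }
    have hK : (⊤ : Subgroup (FreeGroup (Fin 2))).lowerCentralSeries 1 ≤ K := by
      rw [Subgroup.lowerCentralSeries_succ, Subgroup.commutator_le]
      intro g _ h _
      simp [K, commutatorElement_def]
    exact hK
  have h2 : ∀ w ∈ (⊤ : Subgroup (FreeGroup (Fin 2))).lowerCentralSeries 2,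
      (f w).a = 0 ∧ (f w).b = 0 ∧ (f w).z = 0 := by
    let K : Subgroup (FreeGroup (Fin 2)) :=
      { carrier := {w | (f w).a = 0 ∧ (f w).b = 0 ∧ (f w).z = 0}
        mul_mem' := by rintro g h ⟨h1, h2, h3⟩ ⟨h4, h5, h6⟩; simp [*]
        one_mem' := by simp
        inv_mem' := by rintro g ⟨h1, h2, h3⟩; simp [*] }
    have hK : (⊤ : Subgroup (FreeGroup (Fin 2))).lowerCentralSeries 2 ≤ K := by
      rw [Subgroup.lowerCentralSeries_succ, Subgroup.commutator_le]
      intro g hg h _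
      obtain ⟨e1, e2⟩ := h1 g hg
      simp [K, commutatorElement_def, e1, e2]
      ring
    exact hK
  rw [Subgroup.lowerCentralSeries_succ, Subgroup.commutator_le]
  intro g hg h _
  obtain ⟨e1, e2, e3⟩ := h2 g hg
  rw [MonoidHom.mem_ker]
  ext <;> simp [commutatorElement_def, e1, e2, e3]
  all_goals ring

end MomentGroup

/-- The homomorphism from the Cartan group to the moment group with prescribed images of the
generators. -/
def CartanGroup.toMoment (g h : MomentGroup) : CartanGroup →* MomentGroup :=
  QuotientGroup.lift _ (FreeGroup.lift ![g, h]) (MomentGroup.lowerCentralSeries_le_ker _)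

theorem CartanGroup.toMoment_x (g h : MomentGroup) : CartanGroup.toMoment g h CartanGroup.x = g := by
  have e : CartanGroup.toMoment g h CartanGroup.x = FreeGroup.lift ![g, h] (FreeGroup.of 0) := rfl
  rw [e, FreeGroup.lift_apply_of]
  rfl

theorem CartanGroup.toMoment_y (g h : MomentGroup) : CartanGroup.toMoment g h CartanGroup.y = h := by
  have e : CartanGroup.toMoment g h CartanGroup.y = FreeGroup.lift ![g, h] (FreeGroup.of 1) := rfl
  rw [e, FreeGroup.lift_apply_of]
  rfl

/-! ## Words, and the cost of a word relative to a ray -/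

/-- The steps of a lattice path: right, left, up, down. -/
inductive LatticeStep
  | right | left | up | down

namespace LatticeStep

/-- The value of a step in a group with distinguished elements `g` (right) and `h` (up). -/
def val {G : Type*} [Group G] (g h : G) : LatticeStep → G
  | right => g
  | left => g⁻¹
  | up => h
  | down => h⁻¹

/-- The value of a word. -/
def eval {G : Type*} [Group G] (g h : G) (w : List LatticeStep) : G := (w.map (val g h)).prod

theorem eval_append {G : Type*} [Group G] (g h : G) (w w' : List LatticeStep) :
    eval g h (w ++ w') = eval g h w * eval g h w' := by simp [eval]

theorem map_eval {G H : Type*} [Group G] [Group H] (f : G →* H) (g h : G)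
    (w : List LatticeStep) : f (eval g h w) = eval (f g) (f h) w := by
  rw [eval, eval, map_list_prod, List.map_map]
  congr 2
  funext t
  cases t <;> simp [val]

/-- The end of a step that starts at `c`. -/
def move (c : ℤ × ℤ) : LatticeStep → ℤ × ℤ
  | right => (c.1 + 1, c.2)
  | left => (c.1 - 1, c.2)
  | up => (c.1, c.2 + 1)
  | down => (c.1, c.2 - 1)

/-- The end of a lattice path that starts at `c`. -/
def endpt (c : ℤ × ℤ) (w : List LatticeStep) : ℤ × ℤ := w.foldl move c

@[simp] theorem endpt_nil (c : ℤ × ℤ) : endpt c [] = c := rfl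

@[simp] theorem endpt_cons (c : ℤ × ℤ) (t : LatticeStep) (w : List LatticeStep) :
    endpt c (t :: w) = endpt (move c t) w := rfl

theorem endpt_append (c : ℤ × ℤ) (w w' : List LatticeStep) :
    endpt c (w ++ w') = endpt (endpt c w) w' := by simp [endpt]

/-- The number of steps to the left and downwards, with values in `ℝ`. -/
def back : List LatticeStep → ℝ
  | [] => 0
  | right :: w => back w
  | up :: w => back w
  | left :: w => 1 + back w
  | down :: w => 1 + back w

theorem back_append (w w' : List LatticeStep) : back (w ++ w') = back w + back w' := by
  induction w with
  | nil => simp [back]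
  | cons t w ih => cases t <;> simp [back, ih, add_assoc]

theorem back_nonneg (w : List LatticeStep) : 0 ≤ back w := by
  induction w with
  | nil => simp [back]
  | cons t w ih => cases t <;> simp only [back] <;> linarith

/-- Each backward step lengthens the word by one and lowers the coordinate sum by one. This turns an
excess of length over displacement into a count of backward steps. -/
theorem back_eq (c : ℤ × ℤ) (w : List LatticeStep) :
    2 * back w = w.length - (((endpt c w).1 - c.1 : ℤ) : ℝ) - (((endpt c w).2 - c.2 : ℤ) : ℝ) := by
  induction w generalizing c with
  | nil => simp [back]
  | cons t w ih =>
    have := ih (move c t)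
    cases t <;> simp only [back, endpt_cons, move, List.length_cons] at this ⊢ <;>
      push_cast at this ⊢ <;> linarith

/-- The moment of the unit squares of column `a` between height `b` and the ray of slope `s`,
measured by twice the vertical distance from the ray. -/
def columnCost (s : ℝ) (a b : ℤ) : ℝ :=
  (b - s * (a + 1 / 2)) ^ 2 - (s * (a + 1 / 2) - round (s * (a + 1 / 2))) ^ 2

/-- The cost of a step. -/
def stepCost (s : ℝ) (c : ℤ × ℤ) : LatticeStep → ℝ
  | right => columnCost s c.1 c.2
  | left => -columnCost s (c.1 - 1) c.2
  | up => 0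
  | down => 0

/-- The cost of the lattice path `w` from `c`. -/
def cost (s : ℝ) (c : ℤ × ℤ) : List LatticeStep → ℝ
  | [] => 0
  | t :: w => stepCost s c t + cost s (move c t) w

theorem cost_append (s : ℝ) (c : ℤ × ℤ) (w w' : List LatticeStep) :
    cost s c (w ++ w') = cost s c w + cost s (endpt c w) w' := by
  induction w generalizing c with
  | nil => simp [cost]
  | cons t w ih => simp [cost, ih, add_assoc]

/-- `round` gives a nearest integer, so the subtracted square is the minimum of the first one over
all integer heights. -/
theorem columnCost_nonneg (s : ℝ) (a b : ℤ) : 0 ≤ columnCost s a b := by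
  have h := round_le (s * (a + 1 / 2)) b
  rw [abs_sub_comm _ (b : ℝ)] at h
  exact sub_nonneg.2 (sq_le_sq.2 h)

theorem le_columnCost (s : ℝ) (a b : ℤ) :
    (b - s * (a + 1 / 2)) ^ 2 - 1 / 4 ≤ columnCost s a b := by
  have h := abs_le.1 (abs_sub_round (s * (a + 1 / 2)))
  unfold columnCost
  nlinarith

theorem columnCost_le (s : ℝ) (a b : ℤ) : columnCost s a b ≤ (b - s * (a + 1 / 2)) ^ 2 :=
  sub_le_self _ (sq_nonneg _)

/-- Equality in the hypothesis is the tie in which the ray meets the centre of a square. Both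
heights are then nearest, so either choice in the alternation has cost zero. -/
theorem columnCost_eq_zero {s : ℝ} {a b : ℤ} (h : |b - s * (a + 1 / 2)| ≤ 1 / 2) :
    columnCost s a b = 0 := by
  refine le_antisymm ?_ (columnCost_nonneg s a b)
  unfold columnCost
  set r := s * ((a : ℝ) + 1 / 2)
  by_cases hb : b = round r
  · rw [hb]
    nlinarith
  · have h1 : (1 : ℝ) ≤ |(b : ℝ) - round r| := by
      have : (1 : ℤ) ≤ |b - round r| := Int.one_le_abs (sub_ne_zero.2 hb)
      exact_mod_cast this
    have h2 : |(b : ℝ) - round r| ≤ |(b : ℝ) - r| + |r - round r| := abs_sub_le _ _ _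
    -- An integer other than `round r` is at distance at least 1 from it, so `|r - round r| ≥ 1 /
    -- 2`.
    have h3 : |(b : ℝ) - r| ≤ |r - round r| := by linarith
    exact sub_nonpos.2 (sq_le_sq.2 h3)

/-- A primitive of the part of the cost that depends only on the column. -/
theorem exists_primitive (c : ℤ → ℝ) : ∃ T : ℤ → ℝ, T 0 = 0 ∧ ∀ a, T (a + 1) = T a + c a := by
  refine ⟨fun a => ∑ i ∈ Finset.range a.toNat, c i - ∑ i ∈ Finset.range (-a).toNat, c (-i - 1),
    by simp, fun a => ?_⟩
  obtain ⟨n, rfl | rfl⟩ := a.eq_nat_or_neg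
  · have e1 : ((n : ℤ) + 1).toNat = n + 1 := by omega
    have e2 : (-1 + -(n : ℤ)).toNat = 0 := by omega
    simp [e1, e2, Finset.sum_range_succ]
  · rcases n with _ | n
    · simp
    · have e1 : (-((n + 1 : ℕ) : ℤ) + 1).toNat = 0 := by omega
      have e2 : (-(-((n + 1 : ℕ) : ℤ) + 1)).toNat = n := by omega
      have e3 : (-((n + 1 : ℕ) : ℤ)).toNat = 0 := by omega
      have e4 : (- -((n + 1 : ℕ) : ℤ)).toNat = n + 1 := by omega
      have e5 : -((n + 1 : ℕ) : ℤ) = -n - 1 := by push_cast; ring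
      simp only [e1, e2, e3, e4, Finset.sum_range_succ]
      rw [e5]
      ring

theorem endpt_eq_eval (w : List LatticeStep) :
    endpt (0, 0) w = ((eval MomentGroup.X MomentGroup.Y w).a,
      (eval MomentGroup.X MomentGroup.Y w).b) := by
  induction w using List.reverseRecOn with
  | nil => simp [eval]
  | append_singleton w t ih =>
    rw [endpt_append, ih, eval_append]
    cases t <;> simp [eval, val, move, MomentGroup.X, MomentGroup.Y] <;> rfl

/-- The cost of a word depends only on its value in the moment group. -/
theorem cost_eq_of_eval_eq (s : ℝ) {w w' : List LatticeStep}
    (h : eval MomentGroup.X MomentGroup.Y w = eval MomentGroup.X MomentGroup.Y w') :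
    cost s (0, 0) w = cost s (0, 0) w' := by
  obtain ⟨T, hT0, hT⟩ := exists_primitive fun a =>
    (s * (a + 1 / 2)) ^ 2 - (s * (a + 1 / 2) - round (s * (a + 1 / 2))) ^ 2
  -- Expanding the square splits the cost of a step into `b ^ 2`, which sums to `A`, the mixed term
  -- `-s * (2 * a + 1) * b`, which sums to `-s * B`, and a function of the column alone, whose
  -- signed sum telescopes to `T`.
  have key : ∀ v : List LatticeStep, cost s (0, 0) v =
      (eval MomentGroup.X MomentGroup.Y v).A - s * (eval MomentGroup.X MomentGroup.Y v).B +
        T (eval MomentGroup.X MomentGroup.Y v).a := by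
    intro v
    induction v using List.reverseRecOn with
    | nil => simp [eval, cost, hT0]
    | append_singleton w t ih =>
      rw [cost_append, ih, eval_append, endpt_eq_eval]
      set g := eval MomentGroup.X MomentGroup.Y w
      cases t
      · simp [eval, val, MomentGroup.X, cost, stepCost, columnCost, hT]
        ring
      · have := hT (g.a - 1)
        rw [sub_add_cancel] at this
        simp [eval, val, MomentGroup.X, cost, stepCost, columnCost, this, ← sub_eq_add_neg]
        ring
      · simp [eval, val, MomentGroup.Y, cost, stepCost]
      · simp [eval, val, MomentGroup.Y, cost, stepCost]
  rw [key, key, h]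

end LatticeStep

/-! ## Words of zero cost stay close to the ray -/

namespace LatticeStep

/-- The vertical distance of a point above the line of slope `s`. -/
def height (s : ℝ) (c : ℤ × ℤ) : ℝ := c.2 - s * c.1

/-- The potential `(x - 1)₊³ / 3`. -/
def potential (x : ℝ) : ℝ := max (x - 1) 0 ^ 3 / 3

theorem potential_nonneg (x : ℝ) : 0 ≤ potential x := by unfold potential; positivity

theorem potential_eq_zero {x : ℝ} (h : x ≤ 1) : potential x = 0 := by
  simp [potential, max_eq_right (sub_nonpos.2 h)]

theorem potential_mono {x y : ℝ} (h : x ≤ y) : potential x ≤ potential y := by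
  unfold potential
  gcongr

/-- The potential has derivative `(x - 1) ^ 2` for `x ≥ 1`, so it drops by at most `(x - 1) ^ 2`
over a length `s ≤ 1`. The threshold 1 is chosen so that this is at most `(x - 1 / 2) ^ 2 - 1 / 4`,
a lower bound for the cost of a step to the right. -/
theorem potential_sub_le {s x f : ℝ} (h0 : 0 ≤ s) (h1 : s ≤ 1) (hf : 0 ≤ f)
    (hf' : (x - s / 2) ^ 2 - 1 / 4 ≤ f) : potential x - potential (x - s) ≤ f := by
  rcases le_total x 1 with hx | hx
  · rw [potential_eq_zero hx]
    linarith [potential_nonneg (x - s)]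
  · have e1 : max (x - 1) 0 = x - 1 := max_eq_left (by linarith)
    have h2 : (x - 1) ^ 2 ≤ f := by nlinarith
    set y := max (x - s - 1) 0 with hy
    have hy0 : 0 ≤ y := le_max_right _ _
    have hyx : y ≤ x - 1 := max_le (by linarith) (by linarith)
    have hys : x - 1 - y ≤ 1 := by linarith [le_max_left (x - s - 1) 0]
    unfold potential
    rw [e1, ← hy]
    have h3 : (x - 1) ^ 3 - y ^ 3 ≤ 3 * (x - 1) ^ 2 * (x - 1 - y) := by
      nlinarith [mul_nonneg (sub_nonneg.2 hyx) (mul_nonneg (sub_nonneg.2 hyx) hy0),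
        mul_nonneg (sub_nonneg.2 hyx) (mul_nonneg (sub_nonneg.2 hyx) (sub_nonneg.2 hx))]
    have h4 : (x - 1) ^ 2 * (x - 1 - y) ≤ (x - 1) ^ 2 :=
      mul_le_of_le_one_right (sq_nonneg _) hys
    linarith

variable {s M : ℝ}

/-- Only steps to the right and downwards lower the height. The former pay with their cost. The term
`(M + 1) ^ 2` pays for the latter, and it also offsets the negative cost of a step to the left. The
two inequalities serve the two sides of the ray. -/
theorem potential_step (h0 : 0 ≤ s) (h1 : s ≤ 1) {c : ℤ × ℤ} (hc : |height s c| ≤ M)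
    (t : LatticeStep) :
    potential (height s c) - potential (height s (move c t)) ≤
        stepCost s c t + (M + 1) ^ 2 * back [t] ∧
      potential (-height s (move c t)) - potential (-height s c) ≤
        stepCost s c t + (M + 1) ^ 2 * back [t] := by
  obtain ⟨hl, hu⟩ := abs_le.1 hc
  have hM : 0 ≤ M := (abs_nonneg _).trans hc
  cases t with
  | right =>
    have e : height s (move c right) = height s c - s := by simp [height, move]; ring
    have e2 : (c.2 : ℝ) - s * (c.1 + 1 / 2) = height s c - s / 2 := by simp [height]; ring
    have h2 := columnCost_nonneg s c.1 c.2
    have h3 := le_columnCost s c.1 c.2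
    rw [e2] at h3
    simp only [stepCost, back, mul_zero, add_zero, e]
    refine ⟨potential_sub_le h0 h1 h2 h3, ?_⟩
    have := potential_sub_le (x := -(height s c - s)) h0 h1 h2 (by
      convert h3 using 2; ring)
    rwa [show -(height s c - s) - s = -height s c by ring] at this
  | left =>
    have e : height s (move c left) = height s c + s := by simp [height, move]; ring
    have e2 : (c.2 : ℝ) - s * (((c.1 - 1 : ℤ) : ℝ) + 1 / 2) = height s c + s / 2 := by
      simp [height]; ring
    have h3 := columnCost_le s (c.1 - 1) c.2
    rw [e2] at h3
    have h4 : (height s c + s / 2) ^ 2 ≤ (M + 1) ^ 2 :=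
      sq_le_sq.2 (abs_le_abs (by linarith) (by linarith))
    simp only [stepCost, back, add_zero, mul_one, e]
    have h5 := potential_mono (show height s c ≤ height s c + s by linarith)
    have h6 := potential_mono (show -(height s c + s) ≤ -height s c by linarith)
    constructor <;> linarith
  | up =>
    have e : height s (move c up) = height s c + 1 := by simp [height, move]; ring
    simp only [stepCost, back, add_zero, mul_zero, e]
    have h5 := potential_mono (show height s c ≤ height s c + 1 by linarith)
    have h6 := potential_mono (show -(height s c + 1) ≤ -height s c by linarith)
    constructor <;> linarith
  | down =>
    have e : height s (move c down) = height s c - 1 := by simp [height, move]; ring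
    have h4 : (height s c - 1 / 2) ^ 2 ≤ (M + 1) ^ 2 :=
      sq_le_sq.2 (abs_le_abs (by linarith) (by linarith))
    simp only [stepCost, back, add_zero, mul_one, zero_add, e]
    refine ⟨potential_sub_le zero_le_one le_rfl (sq_nonneg _) (by linarith), ?_⟩
    have := potential_sub_le (x := -(height s c - 1)) zero_le_one le_rfl (sq_nonneg (M + 1)) (by
      rw [show (-(height s c - 1) - 1 / 2) ^ 2 = (height s c - 1 / 2) ^ 2 by ring]
      linarith)
    rwa [show -(height s c - 1) - 1 = -height s c by ring] at this

theorem potential_le_cost (h0 : 0 ≤ s) (h1 : s ≤ 1) {c : ℤ × ℤ} {w : List LatticeStep}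
    (hw : ∀ i, |height s (endpt c (w.take i))| ≤ M) :
    potential (height s c) - potential (height s (endpt c w)) ≤
        cost s c w + (M + 1) ^ 2 * back w ∧
      potential (-height s (endpt c w)) - potential (-height s c) ≤
        cost s c w + (M + 1) ^ 2 * back w := by
  induction w generalizing c with
  | nil => simp [cost, back]
  | cons t w ih =>
    have h2 := potential_step h0 h1 (by simpa using hw 0) t
    have h3 := ih (c := move c t) fun i => by simpa using hw (i + 1)
    have h4 : back (t :: w) = back [t] + back w := back_append [t] w
    simp only [cost, endpt_cons, h4]
    constructor <;> nlinarith [h2.1, h2.2, h3.1, h3.2]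

/-- A path of zero cost that ends close to the ray stays close to the ray, at a distance that is
controlled by the number of steps to the left and downwards. -/
theorem abs_height_le_of_cost_eq_zero (h0 : 0 ≤ s) (h1 : s ≤ 1) {w : List LatticeStep}
    (hc : cost s (0, 0) w = 0) (he : |height s (endpt (0, 0) w)| ≤ 1) (i : ℕ) :
    |height s (endpt (0, 0) (w.take i))| ≤ 24 * back w + 3 := by
  obtain ⟨m, -, hm⟩ := Finset.exists_max_image (Finset.range (w.length + 1))
    (fun i => |height s (endpt (0, 0) (w.take i))|) ⟨0, by simp⟩
  set M := |height s (endpt (0, 0) (w.take m))| with hM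
  have hmax : ∀ i, |height s (endpt (0, 0) (w.take i))| ≤ M := by
    intro i
    rcases le_total i w.length with hi | hi
    · exact hm i (by simpa using Nat.lt_succ_of_le hi)
    · rw [List.take_of_length_le hi]
      simpa using hm w.length (by simp)
  refine (hmax i).trans ?_
  by_contra! hlt
  have hb := back_nonneg w
  have hsplit : w = w.take m ++ w.drop m := (List.take_append_drop m w).symm
  set d := endpt (0, 0) (w.take m) with hd
  have hend : endpt (0, 0) w = endpt d (w.drop m) := by
    rw [hd, ← endpt_append, ← hsplit]
  -- Below the ray the way to the extremal vertex has to be paid for, above the ray the way back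
  -- from it. Adding the two estimates treats both cases at once, since the two costs sum to zero.
  have hpre := (potential_le_cost h0 h1 (c := (0, 0)) (w := w.take m) (M := M) fun i => by
    rw [List.take_take]; exact hmax _).2
  have hsuf := (potential_le_cost h0 h1 (c := d) (w := w.drop m) (M := M) fun i => by
    have := hmax (m + i)
    rwa [List.take_add, endpt_append] at this).1
  have hcost : cost s (0, 0) (w.take m) + cost s d (w.drop m) = 0 := by
    rw [← cost_append, ← hsplit, hc]
  have hback : back (w.take m) + back (w.drop m) = back w := by
    rw [← back_append, ← hsplit]
  have hz : potential (-height s (0, 0)) = 0 := potential_eq_zero (by simp [height])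
  rw [← hend, potential_eq_zero (abs_le.1 he).2] at hsuf
  rw [← hd, hz] at hpre
  have hV : potential M ≤ potential (height s d) + potential (-height s d) := by
    rcases abs_cases (height s d) with ⟨h, -⟩ | ⟨h, -⟩
    · rw [hM, h]; linarith [potential_nonneg (-height s d)]
    · rw [hM, h]; linarith [potential_nonneg (height s d)]
  have hfin : potential M ≤ (M + 1) ^ 2 * back w := by
    rw [← hback]; nlinarith
  -- Here `M > 3`, so `M - 1 ≥ (M + 1) / 2`. This is the origin of the constants 24 and 3.
  have hV2 : (M + 1) ^ 3 / 24 ≤ potential M := by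
    have h3 : (M + 1) / 2 ≤ max (M - 1) 0 := le_max_of_le_left (by linarith)
    have h4 : ((M + 1) / 2) ^ 3 ≤ max (M - 1) 0 ^ 3 := by gcongr
    unfold potential
    nlinarith
  have h5 : 0 < (M + 1) ^ 2 := by positivity
  have h6 : (M + 1) ^ 2 * ((M + 1) / 24 - back w) ≤ 0 := by nlinarith
  exact absurd h6 (not_le.2 (mul_pos h5 (by linarith)))

end LatticeStep

/-! ## Staircases as words, and charts adapted to a direction -/

open LatticeStep

/-- The words `W n` are the initial segments of a monotone lattice path that passes every column of
unit squares as close as possible to the ray of slope `s`. -/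
structure IsStaircase (s : ℝ) (W : ℕ → List LatticeStep) : Prop where
  zero : W 0 = []
  step : ∀ n, (W (n + 1) = W n ++ [right] ∧
    |((endpt (0, 0) (W n)).2 : ℝ) - s * ((endpt (0, 0) (W n)).1 + 1 / 2)| ≤ 1 / 2) ∨
      W (n + 1) = W n ++ [up]
  height_le : ∀ n, |height s (endpt (0, 0) (W n))| ≤ 1

namespace IsStaircase

variable {s : ℝ} {W : ℕ → List LatticeStep}

theorem length_eq (h : IsStaircase s W) (n : ℕ) : (W n).length = n := by
  induction n with
  | zero => simp [h.zero]
  | succ n ih => rcases h.step n with ⟨e, -⟩ | e <;> simp [e, ih]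

theorem back_eq_zero (h : IsStaircase s W) (n : ℕ) : back (W n) = 0 := by
  induction n with
  | zero => simp [h.zero, back]
  | succ n ih => rcases h.step n with ⟨e, -⟩ | e <;> simp [e, ih, back_append, back]

theorem cost_eq_zero (h : IsStaircase s W) (n : ℕ) : cost s (0, 0) (W n) = 0 := by
  induction n with
  | zero => simp [h.zero, cost]
  | succ n ih =>
    rcases h.step n with ⟨e, e'⟩ | e
    · simp [e, ih, cost_append, cost, stepCost, columnCost_eq_zero e']
    · simp [e, ih, cost_append, cost, stepCost]

theorem endpt_add (h : IsStaircase s W) (n : ℕ) :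
    (endpt (0, 0) (W n)).1 + (endpt (0, 0) (W n)).2 = n := by
  have h1 := back_eq (0, 0) (W n)
  rw [h.back_eq_zero, h.length_eq] at h1
  have h2 : (((endpt (0, 0) (W n)).1 + (endpt (0, 0) (W n)).2 : ℤ) : ℝ) = (n : ℤ) := by
    push_cast at h1 ⊢
    linarith
  exact_mod_cast h2

theorem fst_nonneg (h : IsStaircase s W) (n : ℕ) : 0 ≤ (endpt (0, 0) (W n)).1 := by
  induction n with
  | zero => simp [h.zero]
  | succ n ih =>
    rcases h.step n with ⟨e, -⟩ | e <;> rw [e, endpt_append] <;> simp [move] <;> omega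

/-- At least half of the steps of a staircase of slope at most one are horizontal. -/
theorem le_fst (h : IsStaircase s W) (h1 : s ≤ 1) (n : ℕ) :
    (n : ℝ) ≤ 2 * (endpt (0, 0) (W n)).1 + 1 := by
  have h2 := (abs_le.1 (h.height_le n)).2
  have h3 : (((endpt (0, 0) (W n)).1 : ℤ) : ℝ) + ((endpt (0, 0) (W n)).2 : ℤ) = n := by
    exact_mod_cast h.endpt_add n
  have h4 : (0 : ℝ) ≤ ((endpt (0, 0) (W n)).1 : ℤ) := by exact_mod_cast h.fst_nonneg n
  unfold height at h2
  nlinarith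

/-- A translate of the staircase at height at least two above or below it has large cost. -/
theorem le_cost_translate (h : IsStaircase s W) (c : ℤ × ℤ) (hc : 2 ≤ |height s c|) (n : ℕ) :
    2 * ((endpt (0, 0) (W n)).1 : ℝ) ≤ cost s c (W n) := by
  induction n with
  | zero => simp [h.zero, cost]
  | succ n ih =>
    have key : ∀ (w : List LatticeStep),
        endpt c w = (c.1 + (endpt (0, 0) w).1, c.2 + (endpt (0, 0) w).2) := by
      intro w
      induction w using List.reverseRecOn with
      | nil => simp
      | append_singleton w t ih =>
        rw [endpt_append, endpt_append, ih]
        cases t <;> simp [move] <;> ring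
    rcases h.step n with ⟨e, e'⟩ | e
    · rw [e, cost_append, endpt_append, key]
      set d := endpt (0, 0) (W n)
      have h2 := le_columnCost s (c.1 + d.1) (c.2 + d.2)
      have h3 : ((c.2 + d.2 : ℤ) : ℝ) - s * (((c.1 + d.1 : ℤ) : ℝ) + 1 / 2) =
          height s c + (d.2 - s * (d.1 + 1 / 2)) := by
        simp [height]; ring
      -- The staircase itself is within `1 / 2` of the ray at mid-column, so the translate is at
      -- distance at least `2 - 1 / 2`, and each column costs at least `9 / 4 - 1 / 4 = 2`.
      have h4 : 3 / 2 ≤ |height s c + (d.2 - s * (d.1 + 1 / 2))| := by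
        have := abs_sub_abs_le_abs_sub (height s c) (-(d.2 - s * (d.1 + 1 / 2)))
        rw [abs_neg, sub_neg_eq_add] at this
        linarith
      have h5 : (9 / 4 : ℝ) ≤ (height s c + (d.2 - s * (d.1 + 1 / 2))) ^ 2 := by
        rw [← sq_abs]; nlinarith
      rw [h3] at h2
      simp only [cost, stepCost, endpt_cons, endpt_nil, move]
      push_cast
      linarith
    · rw [e, cost_append, endpt_append]
      simpa [cost, stepCost, move] using ih

end IsStaircase

namespace Staircase

/-- The sign of a real number, with the sign of zero taken to be positive. -/
def unitSign (r : ℝ) : ℤ := if r < 0 then -1 else 1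

theorem unitSign_eq (r : ℝ) : unitSign r = 1 ∨ unitSign r = -1 := by
  unfold unitSign; split_ifs <;> simp

theorem unitSign_mul_self (r : ℝ) : unitSign r * unitSign r = 1 := by
  rcases unitSign_eq r with h | h <;> simp [h]

theorem unitSign_mul_abs (r : ℝ) : (unitSign r : ℝ) * |r| = r := by
  unfold unitSign
  split_ifs with h
  · simp [abs_of_neg h]
  · simp [abs_of_nonneg (not_lt.1 h)]

theorem sign_eq_unitSign {r : ℝ} (h : (SignType.sign r : ℤ) = 1 ∨ (SignType.sign r : ℤ) = -1) :
    (SignType.sign r : ℤ) = unitSign r := by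
  unfold unitSign
  rcases lt_trichotomy r 0 with hr | rfl | hr
  · simp [hr]
  · simp at h
  · simp [hr, hr.le]

end Staircase

/-- A chart adapted to the direction `u` and the ray `γ`: generators `g`, `h` of the Cartan group,
equal to the standard ones up to order and inversion, for which `γ` is a staircase of slope at most
one in the first quadrant. -/
structure Chart (u : Direction) (γ : ℕ → CartanGroup) where
  g : CartanGroup
  h : CartanGroup
  s : ℝ
  W : ℕ → List LatticeStep
  Θ : CartanGroup →* MomentGroup
  k : ℝ
  s_nonneg : 0 ≤ s
  s_le_one : s ≤ 1
  exists_val : ∀ t ∈ CartanGroup.gens, ∃ r, val g h r = t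
  map_g : Θ g = MomentGroup.X
  map_h : Θ h = MomentGroup.Y
  path_eq : ∀ n, γ n = eval g h (W n)
  isStaircase : IsStaircase s W
  k_ne_zero : k ≠ 0
  -- Since `k ≠ 0`, the height vanishes exactly for the elements that project to the line of `u`.
  height_eq : ∀ c, height s ((Θ c).a, (Θ c).b) =
    k * (u.1 0 * (CartanGroup.hat c).2 - u.1 1 * (CartanGroup.hat c).1)
  sum_eq : ∀ c, (Θ c).a + (Θ c).b = Staircase.unitSign (u.1 0) * (CartanGroup.hat c).1 +
    Staircase.unitSign (u.1 1) * (CartanGroup.hat c).2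

/-! ### Existence of charts -/

namespace Staircase

/-- The invariant of the staircase: its vertices are adjacent to squares on both sides. -/
theorem state_invariant {p q : ℝ} (hp : 0 ≤ p) (hq : 0 ≤ q) (ε : Bool) (n : ℕ) :
    ((state p q ε n).1.1 - 1 / 2 : ℝ) * q ≤ ((state p q ε n).1.2 + 1 / 2 : ℝ) * p ∧
      ((state p q ε n).1.2 - 1 / 2 : ℝ) * p ≤ ((state p q ε n).1.1 + 1 / 2 : ℝ) * q := by
  induction n with
  | zero => simp only [state]; push_cast; constructor <;> nlinarith
  | succ n ih =>
    set σ := state p q ε n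
    by_cases hr : StepsRight p q σ
    · have e : (state p q ε (n + 1)).1 = (σ.1.1 + 1, σ.1.2) := by
        simp only [state, next, if_pos hr, σ]
      rw [e]
      have h := hr.elim le_of_lt fun h => h.1.le
      push_cast
      constructor <;> nlinarith [ih.1, ih.2]
    · have e : (state p q ε (n + 1)).1 = (σ.1.1, σ.1.2 + 1) := by
        simp only [state, next, if_neg hr, σ]
      rw [e]
      have h := not_lt.1 fun h => hr (Or.inl h)
      push_cast
      constructor <;> nlinarith [ih.1, ih.2]

open Classical in
/-- The staircase as a word in two letters. -/
def word (r t : LatticeStep) (p q : ℝ) (ε : Bool) : ℕ → List LatticeStep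
  | 0 => []
  | n + 1 => word r t p q ε n ++ [if StepsRight p q (state p q ε n) then r else t]

theorem endpt_word (p q : ℝ) (ε : Bool) (n : ℕ) :
    endpt (0, 0) (word right up p q ε n) =
      (((state p q ε n).1.1 : ℤ), ((state p q ε n).1.2 : ℤ)) ∧
      endpt (0, 0) (word up right p q ε n) =
        (((state p q ε n).1.2 : ℤ), ((state p q ε n).1.1 : ℤ)) := by
  induction n with
  | zero => simp [word, state]
  | succ n ih =>
    rw [word, word, endpt_append, endpt_append, ih.1, ih.2]
    by_cases hr : StepsRight p q (state p q ε n) <;> simp [hr, state, next, move]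

theorem abs_sub_div_mul_le_iff {p q b t e : ℝ} (hp : 0 < p) :
    |b - q / p * t| ≤ e ↔ |b * p - q * t| ≤ e * p := by
  have h : b - q / p * t = (b * p - q * t) / p := by field_simp
  rw [h, abs_div, abs_of_pos hp, div_le_iff₀ hp]

/-- At a step to the right the square above has its centre on or above the ray, and by the invariant
the square below has its centre on or below it. The bound on the height is the invariant `|b * p - a
* q| ≤ (p + q) / 2` together with `q ≤ p`. -/
theorem isStaircase_word {p q : ℝ} (hp : 0 < p) (hq : 0 ≤ q) (hqp : q ≤ p) (ε : Bool) :
    IsStaircase (q / p) (word right up p q ε) := by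
  refine ⟨rfl, fun n => ?_, fun n => ?_⟩
  · rw [(endpt_word p q ε n).1]
    obtain ⟨h1, h2⟩ := state_invariant hp.le hq ε n
    by_cases hr : StepsRight p q (state p q ε n)
    · left
      refine ⟨by simp [word, hr], ?_⟩
      have h := hr.elim le_of_lt fun h => h.1.le
      push_cast
      rw [abs_sub_div_mul_le_iff hp, abs_le]
      constructor <;> nlinarith
    · right
      simp [word, hr]
  · rw [(endpt_word p q ε n).1]
    obtain ⟨h1, h2⟩ := state_invariant hp.le hq ε n
    simp only [height]
    push_cast
    rw [abs_sub_div_mul_le_iff hp, abs_le]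
    constructor <;> nlinarith

theorem isStaircase_word_swap {p q : ℝ} (hp : 0 ≤ p) (hq : 0 < q) (hpq : p ≤ q) (ε : Bool) :
    IsStaircase (p / q) (word up right p q ε) := by
  refine ⟨rfl, fun n => ?_, fun n => ?_⟩
  · rw [(endpt_word p q ε n).2]
    obtain ⟨h1, h2⟩ := state_invariant hp hq.le ε n
    by_cases hr : StepsRight p q (state p q ε n)
    · right
      simp [word, hr]
    · left
      refine ⟨by simp [word, hr], ?_⟩
      have h := not_lt.1 fun h => hr (Or.inl h)
      push_cast
      rw [abs_sub_div_mul_le_iff hq, abs_le]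
      constructor <;> nlinarith
  · rw [(endpt_word p q ε n).2]
    obtain ⟨h1, h2⟩ := state_invariant hp hq.le ε n
    simp only [height]
    push_cast
    rw [abs_sub_div_mul_le_iff hq, abs_le]
    constructor <;> nlinarith

/-- The functions `SignType.sign` and `unitSign` differ only at zero. If a coordinate of `u` is
zero, the staircase makes no step along that axis, so the difference is never seen. -/
theorem path_eq_eval (u : Direction) (ε : Bool) {g h : CartanGroup} {r t : LatticeStep}
    (hr : val g h r = CartanGroup.x ^ unitSign (u.1 0))
    (ht : val g h t = CartanGroup.y ^ unitSign (u.1 1)) (n : ℕ) :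
    path u ε n = eval g h (word r t |u.1 0| |u.1 1| ε n) := by
  induction n with
  | zero => simp [path, word, eval]
  | succ n ih =>
    rw [path, word, eval_append, ih]
    congr 1
    by_cases hs : StepsRight |u.1 0| |u.1 1| (state |u.1 0| |u.1 1| ε n)
    · have e : (state |u.1 0| |u.1 1| ε (n + 1)).1 =
          ((state |u.1 0| |u.1 1| ε n).1.1 + 1, (state |u.1 0| |u.1 1| ε n).1.2) := by
        simp only [state, next, if_pos hs]
      rcases latticePath_step u ε n with ⟨σ, h1, h2, h3⟩ | ⟨σ, h1, h2, h3⟩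
      · have h4 := sign_eq_unitSign (h2 ▸ h1)
        simp only [latticePath, e, h4]
        simp [eval, hs, hr, mul_add]
      · rw [h3] at e
        simp at e
    · have e : (state |u.1 0| |u.1 1| ε (n + 1)).1 =
          ((state |u.1 0| |u.1 1| ε n).1.1, (state |u.1 0| |u.1 1| ε n).1.2 + 1) := by
        simp only [state, next, if_neg hs]
      rcases latticePath_step u ε n with ⟨σ, h1, h2, h3⟩ | ⟨σ, h1, h2, h3⟩
      · rw [h3] at e
        simp at e
      · have h4 := sign_eq_unitSign (h2 ▸ h1)
        simp only [latticePath, e, h4]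
        simp [eval, hs, ht, mul_add]

theorem toMoment_hat {g h : MomentGroup} (c : CartanGroup) :
    (CartanGroup.toMoment g h c).a =
        (CartanGroup.hat c).1 * g.a + (CartanGroup.hat c).2 * h.a ∧
      (CartanGroup.toMoment g h c).b =
        (CartanGroup.hat c).1 * g.b + (CartanGroup.hat c).2 * h.b := by
  have hc : c ∈ Submonoid.closure CartanGroup.gens := by
    rw [CartanGroup.isSymmGenerating_gens.closure_eq]; trivial
  induction hc using Submonoid.closure_induction with
  | mem t ht =>
    rcases ht with rfl | rfl | rfl | rfl <;>
      simp [CartanGroup.hat_inv, CartanGroup.hat_x, CartanGroup.hat_y, CartanGroup.toMoment_x,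
        CartanGroup.toMoment_y]
  | one => simp [CartanGroup.hat_one]
  | mul c d _ _ hc hd =>
    simp only [map_mul, MomentGroup.mul_a, MomentGroup.mul_b, CartanGroup.hat_mul, Prod.fst_add,
      Prod.snd_add, hc, hd]
    constructor <;> ring

/-- Signs reflect the direction into the first quadrant. If the ray is steeper than the diagonal,
the generators are also exchanged, since the estimates need slope at most one. -/
theorem exists_chart (u : Direction) (ε : Bool) : Nonempty (Chart u (path u ε)) := by
  have h1 := unitSign_eq (u.1 0)
  have h2 := unitSign_eq (u.1 1)
  have h3 := unitSign_mul_abs (u.1 0)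
  have h4 := unitSign_mul_abs (u.1 1)
  have h5 := unitSign_mul_self (u.1 0)
  have h6 := unitSign_mul_self (u.1 1)
  have h5' : (unitSign (u.1 0) : ℝ) * unitSign (u.1 0) = 1 := by exact_mod_cast h5
  have h6' : (unitSign (u.1 1) : ℝ) * unitSign (u.1 1) = 1 := by exact_mod_cast h6
  have hu := coord_ne_zero u
  set σ := unitSign (u.1 0)
  set τ := unitSign (u.1 1)
  have hσ : (σ : ℝ) ≠ 0 := left_ne_zero_of_mul_eq_one h5'
  have hτ : (τ : ℝ) ≠ 0 := left_ne_zero_of_mul_eq_one h6'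
  have hXa (m : ℤ) (hm : m = 1 ∨ m = -1) :
      (MomentGroup.X ^ m).a = m ∧ (MomentGroup.X ^ m).b = 0 := by
    rcases hm with rfl | rfl <;> simp [MomentGroup.X]
  have hYa (m : ℤ) (hm : m = 1 ∨ m = -1) :
      (MomentGroup.Y ^ m).a = 0 ∧ (MomentGroup.Y ^ m).b = m := by
    rcases hm with rfl | rfl <;> simp [MomentGroup.Y]
  rcases le_total |u.1 1| |u.1 0| with hle | hle
  · have hp : 0 < |u.1 0| := by
      refine abs_pos.2 fun h0 => hu ⟨h0, ?_⟩
      rw [h0, abs_zero] at hle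
      exact abs_nonpos_iff.1 hle
    exact ⟨{
      g := CartanGroup.x ^ σ
      h := CartanGroup.y ^ τ
      s := |u.1 1| / |u.1 0|
      W := word right up |u.1 0| |u.1 1| ε
      Θ := CartanGroup.toMoment (MomentGroup.X ^ σ) (MomentGroup.Y ^ τ)
      k := σ * τ / |u.1 0|
      s_nonneg := by positivity
      s_le_one := div_le_one_of_le₀ hle hp.le
      exists_val := by
        rintro t (rfl | rfl | rfl | rfl)
        · rcases h1 with h | h
          · exact ⟨right, by simp [val, h]⟩
          · exact ⟨left, by simp [val, h]⟩
        · rcases h1 with h | h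
          · exact ⟨left, by simp [val, h]⟩
          · exact ⟨right, by simp [val, h]⟩
        · rcases h2 with h | h
          · exact ⟨up, by simp [val, h]⟩
          · exact ⟨down, by simp [val, h]⟩
        · rcases h2 with h | h
          · exact ⟨down, by simp [val, h]⟩
          · exact ⟨up, by simp [val, h]⟩
      map_g := by rw [map_zpow, CartanGroup.toMoment_x, ← zpow_mul, h5, zpow_one]
      map_h := by rw [map_zpow, CartanGroup.toMoment_y, ← zpow_mul, h6, zpow_one]
      path_eq := path_eq_eval u ε rfl rfl
      isStaircase := isStaircase_word hp (abs_nonneg _) hle ε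
      k_ne_zero := by positivity
      height_eq := fun c => by
        rw [height, (toMoment_hat c).1, (toMoment_hat c).2, (hXa σ h1).1, (hXa σ h1).2,
          (hYa τ h2).1, (hYa τ h2).2]
        rw [div_mul_eq_mul_div, div_mul_eq_mul_div, sub_eq_iff_eq_add, ← add_div,
          eq_div_iff hp.ne']
        push_cast
        linear_combination (τ * (CartanGroup.hat c).2 : ℝ) * (σ * h3 - |u.1 0| * h5') -
          (σ * (CartanGroup.hat c).1 : ℝ) * (τ * h4 - |u.1 1| * h6')
      sum_eq := fun c => by
        rw [(toMoment_hat c).1, (toMoment_hat c).2, (hXa σ h1).1, (hXa σ h1).2,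
          (hYa τ h2).1, (hYa τ h2).2]
        ring }⟩
  · have hp : 0 < |u.1 1| := by
      refine abs_pos.2 fun h0 => hu ⟨?_, h0⟩
      rw [h0, abs_zero] at hle
      exact abs_nonpos_iff.1 hle
    exact ⟨{
      g := CartanGroup.y ^ τ
      h := CartanGroup.x ^ σ
      s := |u.1 0| / |u.1 1|
      W := word up right |u.1 0| |u.1 1| ε
      Θ := CartanGroup.toMoment (MomentGroup.Y ^ σ) (MomentGroup.X ^ τ)
      -- The exchange of the axes reverses the orientation, hence the minus sign.
      k := -(σ * τ / |u.1 1|)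
      s_nonneg := by positivity
      s_le_one := div_le_one_of_le₀ hle hp.le
      exists_val := by
        rintro t (rfl | rfl | rfl | rfl)
        · rcases h1 with h | h
          · exact ⟨up, by simp [val, h]⟩
          · exact ⟨down, by simp [val, h]⟩
        · rcases h1 with h | h
          · exact ⟨down, by simp [val, h]⟩
          · exact ⟨up, by simp [val, h]⟩
        · rcases h2 with h | h
          · exact ⟨right, by simp [val, h]⟩
          · exact ⟨left, by simp [val, h]⟩
        · rcases h2 with h | h
          · exact ⟨left, by simp [val, h]⟩
          · exact ⟨right, by simp [val, h]⟩
      map_g := by rw [map_zpow, CartanGroup.toMoment_y, ← zpow_mul, h6, zpow_one]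
      map_h := by rw [map_zpow, CartanGroup.toMoment_x, ← zpow_mul, h5, zpow_one]
      path_eq := path_eq_eval u ε rfl rfl
      isStaircase := isStaircase_word_swap (abs_nonneg _) hp hle ε
      k_ne_zero := neg_ne_zero.2 (by positivity)
      height_eq := fun c => by
        rw [height, (toMoment_hat c).1, (toMoment_hat c).2, (hXa τ h2).1, (hXa τ h2).2,
          (hYa σ h1).1, (hYa σ h1).2]
        rw [← neg_div, div_mul_eq_mul_div, div_mul_eq_mul_div, sub_eq_iff_eq_add, ← add_div,
          eq_div_iff hp.ne']
        push_cast
        linear_combination (σ * (CartanGroup.hat c).1 : ℝ) * (τ * h4 - |u.1 1| * h6') -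
          (τ * (CartanGroup.hat c).2 : ℝ) * (σ * h3 - |u.1 0| * h5')
      sum_eq := fun c => by
        rw [(toMoment_hat c).1, (toMoment_hat c).2, (hXa τ h2).1, (hXa τ h2).2,
          (hYa σ h1).1, (hYa σ h1).2]
        ring }⟩

end Staircase

/-! ## Busemann points of staircases -/

section Rays

variable {G : Type*} [Group G] {S : Set G}

theorem wordLength_ray {γ : ℕ → G} (hγ : IsGeodesicRay S γ) (h0 : γ 0 = 1) (n : ℕ) :
    wordLength S (γ n) = n := by
  have := hγ 0 n
  rwa [zero_add, wordDist, h0, inv_one, one_mul] at this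

theorem busemann_ray (hS : IsSymmGenerating S) {γ : ℕ → G} (hγ : IsGeodesicRay S γ)
    (h0 : γ 0 = 1) (j : ℕ) : busemann S γ (γ j) = -j := by
  refine tendsto_nhds_unique ((tendsto_pi_nhds.1 (busemann_tendsto hS hγ)) (γ j))
    (tendsto_const_nhds.congr' ?_)
  filter_upwards [eventually_ge_atTop j] with n hn
  obtain ⟨k, rfl⟩ := Nat.exists_eq_add_of_le hn
  rw [horoEmbed, wordDist_comm hS, hγ j k, wordDist_comm hS, wordDist, inv_one, one_mul,
    wordLength_ray hγ h0]
  push_cast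
  ring

theorem exists_wordDist_le (hS : IsSymmGenerating S) {γ : ℕ → G} (hγ : IsGeodesicRay S γ)
    (h0 : γ 0 = 1) {h : G} {R : ℝ} (hR : busemann S γ h ≤ R) :
    ∃ n, (wordDist S h (γ n) : ℝ) ≤ n + R + 1 := by
  have ht := (tendsto_pi_nhds.1 (busemann_tendsto hS hγ)) h
  obtain ⟨n, hn⟩ := (ht.eventually (gt_mem_nhds (show busemann S γ h < R + 1 by linarith))).exists
  refine ⟨n, ?_⟩
  have h1 : wordDist S 1 (γ n) = n := by
    rw [wordDist, inv_one, one_mul, wordLength_ray hγ h0]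
  rw [horoEmbed, wordDist_comm hS, wordDist_comm hS _ 1, h1] at hn
  linarith

end Rays

namespace Chart

variable {u : Direction} {γ : ℕ → CartanGroup}

theorem exists_eval (K : Chart u γ) (c : CartanGroup) :
    ∃ w, eval K.g K.h w = c ∧ w.length = wordLength CartanGroup.gens c := by
  obtain ⟨l, hl, hp, hlen⟩ := exists_word CartanGroup.isSymmGenerating_gens c
  suffices h : ∃ w : List LatticeStep, w.map (val K.g K.h) = l by
    obtain ⟨w, hw⟩ := h
    refine ⟨w, by rw [eval, hw, hp], by rw [← hlen, ← hw, List.length_map]⟩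
  clear hp hlen
  induction l with
  | nil => exact ⟨[], rfl⟩
  | cons t l ih =>
    obtain ⟨w, hw⟩ := ih fun s hs => hl s (List.mem_cons_of_mem _ hs)
    obtain ⟨r, hr⟩ := K.exists_val t (hl t List.mem_cons_self)
    exact ⟨r :: w, by rw [List.map_cons, hr, hw]⟩

theorem map_eval_eq (K : Chart u γ) (w : List LatticeStep) :
    K.Θ (eval K.g K.h w) = eval MomentGroup.X MomentGroup.Y w := by
  rw [map_eval, K.map_g, K.map_h]

theorem endpt_eq (K : Chart u γ) (w : List LatticeStep) :
    endpt (0, 0) w = ((K.Θ (eval K.g K.h w)).a, (K.Θ (eval K.g K.h w)).b) := by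
  rw [map_eval_eq, endpt_eq_eval]

/-- A word along which the Busemann function decreases almost at unit speed can be completed to an
almost geodesic word that ends on the ray. -/
theorem exists_completion (K : Chart u γ) (hγ : IsGeodesicRay CartanGroup.gens γ) (h0 : γ 0 = 1)
    {w : List LatticeStep} {R : ℝ}
    (hR : busemann CartanGroup.gens γ (eval K.g K.h w) ≤ R - w.length) :
    ∃ w', cost K.s (0, 0) (w ++ w') = 0 ∧ |height K.s (endpt (0, 0) (w ++ w'))| ≤ 1 ∧
      2 * back (w ++ w') ≤ R + 1 := by
  obtain ⟨n, hn⟩ := exists_wordDist_le CartanGroup.isSymmGenerating_gens hγ h0 hR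
  obtain ⟨w', hw', hlen⟩ := K.exists_eval ((eval K.g K.h w)⁻¹ * γ n)
  rw [wordDist, ← hlen] at hn
  -- The completed word and a word of the staircase spell the same element, so they share cost and
  -- end point.
  have he : eval K.g K.h (w ++ w') = eval K.g K.h (K.W n) := by
    rw [eval_append, hw', mul_inv_cancel_left, K.path_eq]
  have he' : eval MomentGroup.X MomentGroup.Y (w ++ w') =
      eval MomentGroup.X MomentGroup.Y (K.W n) := by
    rw [← K.map_eval_eq, he, K.map_eval_eq]
  have hend : endpt (0, 0) (w ++ w') = endpt (0, 0) (K.W n) := by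
    rw [endpt_eq_eval, endpt_eq_eval, he']
  refine ⟨w', ?_, ?_, ?_⟩
  · rw [cost_eq_of_eval_eq K.s he', K.isStaircase.cost_eq_zero]
  · rw [hend]
    exact K.isStaircase.height_le n
  -- The staircase has no backward steps, so twice the number of those of `w ++ w'` is the
  -- difference of the two lengths.
  · have h1 := back_eq (0, 0) (w ++ w')
    have h2 := back_eq (0, 0) (K.W n)
    rw [K.isStaircase.back_eq_zero, K.isStaircase.length_eq] at h2
    rw [hend, List.length_append] at h1
    push_cast at h1 h2
    linarith

/-- Elements along which the Busemann function decreases almost at unit speed project close to the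
ray. -/
theorem exists_hat_bound (K : Chart u γ) (hγ : IsGeodesicRay CartanGroup.gens γ) (h0 : γ 0 = 1)
    (R : ℝ) : ∃ C : ℝ, ∀ (c : CartanGroup),
      busemann CartanGroup.gens γ c ≤ R - wordLength CartanGroup.gens c →
      |(CartanGroup.hat c).1 * (|u.1 0| + |u.1 1|) - wordLength CartanGroup.gens c * u.1 0| ≤ C ∧
      |(CartanGroup.hat c).2 * (|u.1 0| + |u.1 1|) - wordLength CartanGroup.gens c * u.1 1| ≤ C := by
  -- This is `24 * back + 3` for at most `(R + 1) / 2` backward steps.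
  set M := 12 * (R + 1) + 3 with hM
  refine ⟨(R + 1) * |u.1 0| + (R + 1) * |u.1 1| + M / |K.k|, fun c hc => ?_⟩
  obtain ⟨w, rfl, hlen⟩ := K.exists_eval c
  rw [← hlen] at hc ⊢
  obtain ⟨w', h1, h2, h3⟩ := K.exists_completion hγ h0 hc
  have h4 := abs_height_le_of_cost_eq_zero K.s_nonneg K.s_le_one h1 h2 w.length
  rw [List.take_left, K.endpt_eq, K.height_eq, abs_mul] at h4
  have h5 := K.sum_eq (eval K.g K.h w)
  have h6 := back_eq (0, 0) w
  have hk : 0 < |K.k| := abs_pos.2 K.k_ne_zero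
  rw [back_append] at h3 h4
  have h7 := back_nonneg w
  have h8 := back_nonneg w'
  rw [K.endpt_eq] at h6
  have h5' : ((K.Θ (eval K.g K.h w)).a : ℝ) + (K.Θ (eval K.g K.h w)).b =
      Staircase.unitSign (u.1 0) * (CartanGroup.hat (eval K.g K.h w)).1 +
    Staircase.unitSign (u.1 1) * (CartanGroup.hat (eval K.g K.h w)).2 := by exact_mod_cast h5
  have e1 := Staircase.unitSign_mul_abs (u.1 0)
  have e2 := Staircase.unitSign_mul_abs (u.1 1)
  have a1 : |(Staircase.unitSign (u.1 0) : ℝ)| = 1 := by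
    rcases Staircase.unitSign_eq (u.1 0) with h | h <;> simp [h]
  have a2 : |(Staircase.unitSign (u.1 1) : ℝ)| = 1 := by
    rcases Staircase.unitSign_eq (u.1 1) with h | h <;> simp [h]
  have f1 : (Staircase.unitSign (u.1 0) : ℝ) * Staircase.unitSign (u.1 0) = 1 := by
    exact_mod_cast Staircase.unitSign_mul_self (u.1 0)
  have f2 : (Staircase.unitSign (u.1 1) : ℝ) * Staircase.unitSign (u.1 1) = 1 := by
    exact_mod_cast Staircase.unitSign_mul_self (u.1 1)
  push_cast at h6
  set a : ℝ := ((CartanGroup.hat (eval K.g K.h w)).1 : ℝ)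
  set b : ℝ := ((CartanGroup.hat (eval K.g K.h w)).2 : ℝ)
  set σ : ℝ := (Staircase.unitSign (u.1 0) : ℝ)
  set τ : ℝ := (Staircase.unitSign (u.1 1) : ℝ)
  set δ : ℝ := u.1 0 * b - u.1 1 * a with hδ
  have hδM : |δ| ≤ M / |K.k| := by
    rw [le_div_iff₀ hk]
    linarith
  have hS : |σ * a + τ * b - w.length| ≤ R + 1 := by
    rw [abs_le]
    constructor <;> linarith
  have g1 : |u.1 0| = σ * u.1 0 := by linear_combination σ * e1 - |u.1 0| * f1
  have g2 : |u.1 1| = τ * u.1 1 := by linear_combination τ * e2 - |u.1 1| * f2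
  -- The vector `(a, b)` is recovered from its determinant `δ` with `u`, which the height controls,
  -- and from `σ * a + τ * b`, which differs from the length by twice the number of backward steps.
  have k1 : a * (|u.1 0| + |u.1 1|) - w.length * u.1 0 =
      (σ * a + τ * b - w.length) * u.1 0 - τ * δ := by
    rw [g1, g2, hδ]; ring
  have k2 : b * (|u.1 0| + |u.1 1|) - w.length * u.1 1 =
      (σ * a + τ * b - w.length) * u.1 1 + σ * δ := by
    rw [g1, g2, hδ]; ring
  have m1 := mul_le_mul_of_nonneg_right hS (abs_nonneg (u.1 0))
  have m2 := mul_le_mul_of_nonneg_right hS (abs_nonneg (u.1 1))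
  have n1 : 0 ≤ (R + 1) * |u.1 0| := (mul_nonneg (abs_nonneg _) (abs_nonneg _)).trans m1
  have n2 : 0 ≤ (R + 1) * |u.1 1| := (mul_nonneg (abs_nonneg _) (abs_nonneg _)).trans m2
  constructor
  · rw [k1]
    refine (abs_sub _ _).trans ?_
    rw [abs_mul, abs_mul, a2]
    linarith
  · rw [k2]
    refine (abs_add_le _ _).trans ?_
    rw [abs_mul, abs_mul, a1]
    linarith

/-- An element whose left translation moves the Busemann function by a bounded function projects
to the line of the ray, up to a bounded distance. -/
theorem abs_height_lt_two (K : Chart u γ) (hγ : IsGeodesicRay CartanGroup.gens γ) (h0 : γ 0 = 1)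
    {c : CartanGroup} {R : ℝ} (hR : ∀ j : ℕ, busemann CartanGroup.gens γ (c * γ j) ≤ R - j) :
    |height K.s ((K.Θ c).a, (K.Θ c).b)| < 2 := by
  by_contra! hlt
  obtain ⟨w, rfl, -⟩ := K.exists_eval c
  rw [← K.endpt_eq] at hlt
  set R' := R + w.length with hR'
  set M := 12 * (R' + 1) + 3 with hM
  -- The three parts of the completed word cost `cost K.s (0, 0) w`, at least `j - 1`, and at least
  -- `-(M + 1) ^ 2 * ((R' + 1) / 2)`. For this `j` the total cannot be zero.
  obtain ⟨j, hj⟩ := exists_nat_gt (1 - cost K.s (0, 0) w + (M + 1) ^ 2 * ((R' + 1) / 2))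
  have hc : busemann CartanGroup.gens γ (eval K.g K.h (w ++ K.W j)) ≤
      R' - (w ++ K.W j).length := by
    rw [eval_append, ← K.path_eq, List.length_append, K.isStaircase.length_eq]
    push_cast
    linarith [hR j]
  obtain ⟨w', h1, h2, h3⟩ := K.exists_completion hγ h0 hc
  have h4 := abs_height_le_of_cost_eq_zero K.s_nonneg K.s_le_one h1 h2
  have h5 : back (w ++ K.W j ++ w') = back w + back w' := by
    rw [back_append, back_append, K.isStaircase.back_eq_zero, add_zero]
  have h6 := (potential_le_cost K.s_nonneg K.s_le_one (c := endpt (0, 0) (w ++ K.W j)) (w := w')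
    (M := M) fun i => by
      have := h4 ((w ++ K.W j).length + i)
      rw [List.take_length_add_append, endpt_append] at this
      linarith).1
  rw [← endpt_append, potential_eq_zero (abs_le.1 h2).2] at h6
  rw [cost_append, cost_append] at h1
  have h7 := K.isStaircase.le_cost_translate (endpt (0, 0) w) hlt j
  have h8 := K.isStaircase.le_fst K.s_le_one j
  have h9 := potential_nonneg (height K.s (endpt (0, 0) (w ++ K.W j)))
  have h10 : back w' ≤ (R' + 1) / 2 := by linarith [back_nonneg w]
  have h11 : (M + 1) ^ 2 * back w' ≤ (M + 1) ^ 2 * ((R' + 1) / 2) :=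
    mul_le_mul_of_nonneg_left h10 (sq_nonneg _)
  linarith

end Chart

/-! ### Separation of the classes, and stabilizers -/

namespace Staircase

/-- The points of `γ_u` satisfy the hypothesis of `exists_hat_bound` for `u` and, after a bounded
change, for `v`. Their projections are thus close to two rays at once. -/
theorem injective_toReduced (ε : Direction → Bool) :
    Function.Injective fun u : Direction => (busemannPt u (ε u)).toReduced := by
  intro u v huv
  obtain ⟨R, hR⟩ : ∃ R : ℝ, ∀ h, |(busemannPt u (ε u)).1 h - (busemannPt v (ε v)).1 h| ≤ R :=
    Quotient.exact huv
  obtain ⟨Ku⟩ := exists_chart u (ε u)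
  obtain ⟨Kv⟩ := exists_chart v (ε v)
  have hgu := isGeodesicRay_path u (ε u)
  have hgv := isGeodesicRay_path v (ε v)
  obtain ⟨C, hC⟩ := Ku.exists_hat_bound hgu rfl 0
  obtain ⟨D, hD⟩ := Kv.exists_hat_bound hgv rfl R
  have hb := busemann_ray CartanGroup.isSymmGenerating_gens hgu rfl
  have hlen := wordLength_ray hgu rfl
  have hC' := fun j => hC (path u (ε u) j) (by rw [hb, hlen]; simp)
  have hD' := fun j => hD (path u (ε u) j) (by
    have h1 := (abs_le.1 (hR (path u (ε u) j))).1
    change -R ≤ busemann CartanGroup.gens (path u (ε u)) _ -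
      busemann CartanGroup.gens (path v (ε v)) _ at h1
    rw [hb] at h1
    rw [hlen]
    linarith)
  simp only [hlen] at hC' hD'
  set U := |u.1 0| + |u.1 1|
  set V := |v.1 0| + |v.1 1|
  have hU : 0 ≤ U := by positivity
  have hV : 0 ≤ V := by positivity
  -- The multiples `j * (r / U)` and `j * (s / V)` stay at bounded distance from the same `f j`, so
  -- their rates agree. The statement avoids division.
  have key : ∀ {r s : ℝ} (f : ℕ → ℝ), (∀ j : ℕ, |f j * U - j * r| ≤ C) →
      (∀ j : ℕ, |f j * V - j * s| ≤ D) → r * V = s * U := by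
    intro r s f h1 h2
    by_contra hne
    have hpos : 0 < |r * V - s * U| := abs_pos.2 (sub_ne_zero.2 hne)
    obtain ⟨j, hj⟩ := exists_nat_gt ((C * V + D * U) / |r * V - s * U|)
    rw [div_lt_iff₀ hpos] at hj
    have e : (j : ℝ) * (r * V - s * U) = (f j * V - j * s) * U - (f j * U - j * r) * V := by ring
    have h3 : (j : ℝ) * |r * V - s * U| ≤ C * V + D * U := by
      rw [← Nat.abs_cast j, ← abs_mul, e]
      refine (abs_sub _ _).trans ?_
      rw [abs_mul, abs_mul, abs_of_nonneg hU, abs_of_nonneg hV]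
      linarith [mul_le_mul_of_nonneg_right (h1 j) hV, mul_le_mul_of_nonneg_right (h2 j) hU]
    linarith
  have k0 := key _ (fun j => (hC' j).1) fun j => (hD' j).1
  have k1 := key _ (fun j => (hC' j).2) fun j => (hD' j).2
  have hvec : V • u.1 = U • v.1 := by
    ext i
    fin_cases i
    · simpa [mul_comm] using k0
    · simpa [mul_comm] using k1
  have hUV : V = U := by
    have := congrArg norm hvec
    simpa [norm_smul, abs_of_nonneg hU, abs_of_nonneg hV] using this
  have hU0 : U ≠ 0 := by
    intro h
    have h1 := abs_nonneg (u.1 0)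
    have h2 := abs_nonneg (u.1 1)
    exact coord_ne_zero u ⟨abs_nonpos_iff.1 (by linarith), abs_nonpos_iff.1 (by linarith)⟩
  rw [hUV] at hvec
  exact Subtype.ext (smul_right_injective _ hU0 hvec)

/-- The bound in `abs_height_lt_two` is the same for all powers of `g`, while the height of a power
is proportional to its exponent. -/
theorem det_hat_eq_zero {u : Direction} {ε : Bool} {g : CartanGroup}
    (hg : g ∈ MulAction.stabilizer CartanGroup (busemannPt u ε).toReduced) :
    u.1 0 * (CartanGroup.hat g).2 - u.1 1 * (CartanGroup.hat g).1 = 0 := by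
  by_contra hne
  obtain ⟨K⟩ := exists_chart u ε
  have hγ := isGeodesicRay_path u ε
  set δ := u.1 0 * (CartanGroup.hat g).2 - u.1 1 * (CartanGroup.hat g).1 with hδ
  have hpos : 0 < |K.k * δ| := abs_pos.2 (mul_ne_zero K.k_ne_zero hne)
  obtain ⟨N, hN⟩ := exists_nat_gt (2 / |K.k * δ|)
  rw [div_lt_iff₀ hpos] at hN
  have hstab : (g ^ N) • (busemannPt u ε).toReduced = (busemannPt u ε).toReduced :=
    pow_mem hg N
  obtain ⟨R, hR⟩ : ∃ R : ℝ, ∀ h, |(g ^ N • busemannPt u ε).1 h - (busemannPt u ε).1 h| ≤ R :=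
    Quotient.exact hstab
  have h2 := K.abs_height_lt_two hγ rfl (c := (g ^ N)⁻¹)
    (R := R + busemann CartanGroup.gens (path u ε) (g ^ N)⁻¹) (by
      intro j
      have h1 := (abs_le.1 (hR (path u ε j))).2
      change (busemann CartanGroup.gens (path u ε) ((g ^ N)⁻¹ * path u ε j) -
        busemann CartanGroup.gens (path u ε) (g ^ N)⁻¹) -
          busemann CartanGroup.gens (path u ε) (path u ε j) ≤ R at h1
      rw [busemann_ray CartanGroup.isSymmGenerating_gens hγ rfl] at h1
      linarith)
  have hhat : CartanGroup.hat (g ^ N)⁻¹ = -((N : ℤ) • CartanGroup.hat g) := by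
    rw [CartanGroup.hat_inv, ← CartanGroup.hat_zpow, zpow_natCast]
  rw [K.height_eq, hhat] at h2
  have e : K.k * (u.1 0 * ((-((N : ℤ) • CartanGroup.hat g)).2 : ℤ) -
      u.1 1 * ((-((N : ℤ) • CartanGroup.hat g)).1 : ℤ)) = -(N * (K.k * δ)) := by
    rw [hδ]
    simp
    ring
  rw [e, abs_neg, abs_mul, Nat.abs_cast] at h2
  linarith

theorem norm_sq_eq_one (u : Direction) : u.1 0 * u.1 0 + u.1 1 * u.1 1 = 1 := by
  have h : ‖u.1‖ = 1 := by simp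
  have := EuclideanSpace.real_norm_sq_eq u.1
  rw [h, Fin.sum_univ_two] at this
  linarith

end Staircase

/-! ### The commutator subgroup, and the theorem -/

namespace CartanGroup

theorem hat_eq_zero_iff (g : CartanGroup) : hat g = 0 ↔ g ∈ commutator CartanGroup := by
  constructor
  · intro hg
    have key : ∀ c : CartanGroup, Abelianization.of c =
        Abelianization.of x ^ (hat c).1 * Abelianization.of y ^ (hat c).2 := by
      intro c
      have hc : c ∈ Submonoid.closure gens := by
        rw [isSymmGenerating_gens.closure_eq]; trivial
      induction hc using Submonoid.closure_induction with
      | mem t ht => rcases ht with rfl | rfl | rfl | rfl <;> simp [hat_inv, hat_x, hat_y]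
      | one => simp [hat_one]
      | mul c d _ _ hc hd =>
        rw [map_mul, hc, hd, hat_mul, Prod.fst_add, Prod.snd_add, zpow_add, zpow_add]
        exact mul_mul_mul_comm _ _ _ _
    have h1 : Abelianization.of g = 1 := by rw [key, hg]; simp
    rw [← Abelianization.ker_of]
    exact h1
  · intro hg
    exact Abelianization.commutator_subset_ker hatHom hg

end CartanGroup

theorem Direction.uncountable : Uncountable Direction := by
  let f : Set.Icc (0 : ℝ) 1 → Direction := fun t =>
    ⟨!₂[(t : ℝ), √(1 - (t : ℝ) ^ 2)], by
      have h1 : (t : ℝ) ^ 2 ≤ 1 := pow_le_one₀ t.2.1 t.2.2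
      rw [mem_sphere_zero_iff_norm, EuclideanSpace.norm_eq, Fin.sum_univ_two]
      simp [Real.sq_sqrt (sub_nonneg.2 h1)]⟩
  have hf : Function.Injective f := fun s t h =>
    Subtype.ext (congrFun (congrArg (fun w : Direction => w.1.ofLp) h) 0)
  have : Uncountable (Set.Icc (0 : ℝ) 1) := by
    rw [← Cardinal.aleph0_lt_mk_iff, Cardinal.mk_Icc_real zero_lt_one]
    exact Cardinal.aleph0_lt_continuum
  exact hf.uncountable

theorem mainTheorem1 (ε : Direction → Bool) :
    (Function.Injective fun u : Direction => (Staircase.busemannPt u (ε u)).toReduced) ∧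
    ¬ (reducedBusemannPoints CartanGroup.isSymmGenerating_gens).Countable ∧
    ∀ u : Direction,
      (MulAction.stabilizer CartanGroup (Staircase.busemannPt u (ε u)).toReduced :
          Set CartanGroup) ⊆
        {g | CartanGroup.hatVec g ∈ Submodule.span ℝ {(u : EuclideanSpace ℝ (Fin 2))}} ∧
      (¬ u.IsRational →
        {g | CartanGroup.hatVec g ∈ Submodule.span ℝ {(u : EuclideanSpace ℝ (Fin 2))}} =
          (commutator CartanGroup : Set CartanGroup)) := by
  have hinj := Staircase.injective_toReduced ε
  refine ⟨hinj, fun hcount => ?_, fun u => ⟨fun g hg => ?_, fun hu => ?_⟩⟩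
  · have hsub : Set.range (fun u : Direction => (Staircase.busemannPt u (ε u)).toReduced) ⊆
        reducedBusemannPoints CartanGroup.isSymmGenerating_gens := by
      rintro _ ⟨u, rfl⟩
      exact ⟨_, _, rfl⟩
    have := (hcount.mono hsub).preimage_of_injOn hinj.injOn
    rw [Set.preimage_range, Set.countable_univ_iff] at this
    exact not_countable_iff.2 Direction.uncountable this
  · have h1 := Staircase.det_hat_eq_zero hg
    have h2 := Staircase.norm_sq_eq_one u
    -- As `u` is a unit vector, the coefficient is the scalar product with `u`.
    refine Submodule.mem_span_singleton.2
      ⟨u.1 0 * (CartanGroup.hat g).1 + u.1 1 * (CartanGroup.hat g).2, ?_⟩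
    ext i
    fin_cases i
    · simp [CartanGroup.hatVec]
      linear_combination (CartanGroup.hat g).1 * h2 + u.1 1 * h1
    · simp [CartanGroup.hatVec]
      linear_combination (CartanGroup.hat g).2 * h2 - u.1 0 * h1
  · ext g
    rw [SetLike.mem_coe, ← CartanGroup.hat_eq_zero_iff, Set.mem_ofPred_eq,
      Submodule.mem_span_singleton]
    constructor
    · rintro ⟨t, ht⟩
      by_contra hne
      refine hu ?_
      have ht0 : t ≠ 0 := by
        rintro rfl
        rw [zero_smul] at ht
        have e0 := congrFun (congrArg (fun w => w.ofLp) ht) 0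
        have e1 := congrFun (congrArg (fun w => w.ofLp) ht) 1
        simp [CartanGroup.hatVec] at e0 e1
        exact hne (Prod.ext (by exact_mod_cast e0.symm) (by exact_mod_cast e1.symm))
      have hv : (u : EuclideanSpace ℝ (Fin 2)) = t⁻¹ • CartanGroup.hatVec g := by
        rw [← ht, smul_smul, inv_mul_cancel₀ ht0, one_smul]
      -- `Direction.IsRational` asks for a positive factor, so the integer vector is reversed if `t
      -- < 0`.
      rcases lt_or_gt_of_ne ht0 with hneg | hpos
      · refine ⟨-(CartanGroup.hat g).1, -(CartanGroup.hat g).2, fun h => hne ?_, -t⁻¹,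
          neg_pos.2 (inv_lt_zero.2 hneg), ?_⟩
        · simp only [Prod.mk.injEq, neg_eq_zero] at h
          exact Prod.ext h.1 h.2
        · rw [hv]
          ext i
          fin_cases i <;> simp [CartanGroup.hatVec]
      · exact ⟨(CartanGroup.hat g).1, (CartanGroup.hat g).2, hne, t⁻¹, inv_pos.2 hpos, hv⟩
    · intro h
      refine ⟨0, ?_⟩
      rw [zero_smul]
      ext i
      fin_cases i <;> simp [CartanGroup.hatVec, h]

end
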